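/- **Model at time $k$, given time $k-1$.** Let $\Theta$ be a Polish space, $\alpha>0$, $H$ a probability measure on $\Theta$, and $\varphi$ a Markov kernel on $\Theta$. From time $k-1$ there are $D$ transitioned clusters with parameters $\theta^*_1,\dots,\theta^*_D\in\Theta$ and cardinalities $v^*_1,\dots,v^*_D\in\{0,1,2,\dots\}$ ($v^*_j=0$ means that cluster $j$ does not transition). At time $k$, objects $\ell=1,\dots,N$ receive a cluster parameter $\theta_\ell\in\Theta$ and a cluster assignment $c_\ell\in\{1,\dots,D,\mathrm{new}\}$ ($c_\ell=j$: transitioned cluster $j$; $c_\ell=\mathrm{new}$: a cluster created at time $k$). Given the previous $\ell-1$ objects and with $g=(\ell-1)+\alpha+\sum_j v^*_j$, object $\ell$ * joins a cluster that already contains $v\ge 1$ of the previous objects, and takes over its parameter and assignment, with probability $(v+v^*_j)/g$ if it is the transitioned cluster $j$, and $v/g$ if it was created at time $k$; * joins a transitioned cluster $j$ not yet occupied with probability $v^*_j/g$, and then $\theta_\ell\sim\varphi(\theta^*_j,\cdot)$, $c_\ell=j$; * creates a new cluster with probability $\alpha/g$, and then $\theta_\ell\sim H$, $c_\ell=\mathrm{new}$.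 Let $G_0$ be the resulting joint law (the prior) of $s=(\theta_\ell,c_\ell)_{\ell\le N}$. Given the parameters, the measurements $\mathcal Z_k=(z_1,\dots,z_N)$ are independent, $z_\ell$ having likelihood $R(z_\ell\mid\theta_\ell,x_\ell)\in[0,\infty)$, measurable in $\theta_\ell$, where $x_\ell$ is the given state of object $\ell$. The posterior is $$G(ds\mid\mathcal Z_k)=\frac{\prod_{\ell}R(z_\ell\mid\theta_\ell,x_\ell)\,G_0(ds)}{\int\prod_{\ell}R(z_\ell\mid\theta_\ell,x_\ell)\,dG_0}.$$ **Gibbs sampler.** One iteration updates $(\theta_\ell,c_\ell)$ for $\ell=1,\dots,N$ in turn. The new value of $(\theta_\ell,c_\ell)$ is drawn from the normalisation of $$\sum_{C}(v_C+v^*_C)\,R(z_\ell\mid\theta_C,x_\ell)\,\delta_{(\theta_C,c_C)}+\sum_{j}v^*_j\,R(z_\ell\mid\theta,x_\ell)\,\varphi(\theta^*_j,d\theta)\otimes\delta_{j}+\alpha\,R(z_\ell\mid\theta,x_\ell)\,H(d\theta)\otimes\delta_{\mathrm{new}},$$ where the first sum is over the clusters $C$ formed by the other $N-1$ objects, with parameter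 $\theta_C$, assignment $c_C$ and $v_C$ members ($v^*_C=v^*_j$ if $C$ is the transitioned cluster $j$, and $v^*_C=0$ if $C$ was created at time $k$), and the second is over the transitioned clusters $j$ not occupied by the other objects. Let $\Psi^{(n)}_k(s_0,\cdot)$ be the law of the chain after $n$ iterations from $s_0$. **Theorem.** Let $x_1,\dots,x_N$ and $z_1,\dots,z_N$ be such that $\int R(z_\ell\mid\theta,x_\ell)\,H(d\theta)>0$ for every $\ell$ and $\int\prod_\ell R(z_\ell\mid\theta_\ell,x_\ell)\,dG_0<\infty$. Then $G(\cdot\mid\mathcal Z_k)$ is a probability measure, the Gibbs sampler is a Markov kernel, and for $G_0$-almost every initial condition $s_0$ (hence also for $G(\cdot\mid\mathcal Z_k)$-almost every $s_0$) $$\big\|\Psi^{(n)}_k(s_0,\cdot)-G(\cdot\mid\mathcal Z_k)\big\|_{\mathrm{TV}}\to0\qquad(n\to\infty).$$ The same convergence holds for the laws of the cluster parameters $(\theta_1,\dots,\theta_N)$ alone. -/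

import Mathlib

open MeasureTheory ProbabilityTheory Filter Topology
open scoped ENNReal NNReal

noncomputable section

/-- Labels: `some j` is the `j`-th cluster transitioned from time `k - 1`, `none` marks a cluster
created at time `k`. All sets of labels are measurable. -/
instance labelMeasurableSpace (D : ℕ) : MeasurableSpace (Option (Fin D)) := ⊤

instance labelDiscrete (D : ℕ) : DiscreteMeasurableSpace (Option (Fin D)) := ⟨fun _ => trivial⟩

/-- The dependent Dirichlet process model at time `k`, given the configuration at time `k - 1`.
* `α`, `H`: concentration parameter and base distribution;
* `φ`: transition kernel of the cluster parameters;
* `D`, `θstar`, `vstar`: number of transitioned clusters, their parameters at time `k - 1`, and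
  their cardinalities `v*` after the transition (a cluster with `v* = 0` does not transition: it
  gets weight `0` below, so the transition indicator `λ` is already contained in `v*`);
* `R θ x z`: likelihood `R(z | θ, x)` of the measurement `z` given the cluster parameter `θ` and
  the object state `x`. -/
structure DDPModel (Θ 𝓧 𝓩 : Type*) [MeasurableSpace Θ] where
  α : ℝ≥0
  α_pos : 0 < α
  H : Measure Θ
  isProb_H : IsProbabilityMeasure H
  φ : Kernel Θ Θ
  isMarkov_φ : IsMarkovKernel φ
  D : ℕ
  θstar : Fin D → Θ
  vstar : Fin D → ℕ
  R : Θ → 𝓧 → 𝓩 → ℝ≥0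
  measurable_R : ∀ x z, Measurable fun θ => R θ x z

namespace DDPModel

variable {Θ 𝓧 𝓩 : Type*} [MeasurableSpace Θ] (M : DDPModel Θ 𝓧 𝓩)

attribute [instance] DDPModel.isProb_H DDPModel.isMarkov_φ

/-- The pair (cluster parameter, cluster assignment) of one object. -/
abbrev Atom : Type _ := Θ × Option (Fin M.D)

/-- The cluster parameters and cluster assignments of `N` objects. -/
abbrev State (N : ℕ) : Type _ := Fin N → M.Atom

/-! ### The prior -/

/-- Number of objects assigned to the transitioned cluster `j`. -/
def occ {ι : Type*} [Fintype ι] (c : ι → Option (Fin M.D)) (j : Fin M.D) : ℕ :=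
  (Finset.univ.filter fun i => c i = some j).card

/-- Weight with which a new object joins the cluster of object `i`, per member of that cluster.
For a transitioned cluster `j` with `v` members it is `(v + v*) / v`, so that the cluster as a
whole has weight `v + v*`. For a cluster created at time `k` it is `1`, so that the cluster as a
whole has weight `v`. -/
def joinWeight {ι : Type*} [Fintype ι] (c : ι → Option (Fin M.D)) (i : ι) : ℝ≥0∞ :=
  match c i with
  | none => 1
  | some j => ((M.occ c j : ℝ≥0∞) + M.vstar j) / M.occ c j

/-- Weight of a not yet occupied transitioned cluster `j`, zero if `j` is already occupied. -/
def freshWeight {ι : Type*} [Fintype ι] (c : ι → Option (Fin M.D)) (j : Fin M.D) : ℝ≥0∞ :=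
  if M.occ c j = 0 then (M.vstar j : ℝ≥0∞) else 0

/-- Unnormalised law of the (parameter, assignment) of the last object to be clustered, given those
of the other objects. The three summands are: join an occupied cluster and copy its parameter;
select a not yet occupied transitioned cluster `j` and draw the parameter from `φ(θ*_j, ·)`;
create a new cluster and draw the parameter from `H`. -/
def urnMeasure {ι : Type*} [Fintype ι] (s : ι → M.Atom) : Measure M.Atom :=
  (∑ i, M.joinWeight (fun i' => (s i').2) i • Measure.dirac (s i))
    + (∑ j, M.freshWeight (fun i' => (s i').2) j •
        (M.φ (M.θstar j)).prod (Measure.dirac (some j)))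
    + (M.α : ℝ≥0∞) • M.H.prod (Measure.dirac none)

lemma measurable_urnMeasure {ι : Type*} [Fintype ι] :
    Measurable (M.urnMeasure : (ι → M.Atom) → Measure M.Atom) := by
  have hlab : Measurable fun (s : ι → M.Atom) (i : ι) => (s i).2 := by fun_prop
  refine Measure.measurable_of_measurable_coe _ fun A hA => ?_
  simp only [urnMeasure, Measure.add_apply, Measure.finsetSum_apply, Measure.smul_apply,
    smul_eq_mul]
  refine (Measurable.add (Finset.measurable_sum _ fun i _ => ?_)
    (Finset.measurable_sum _ fun j _ => ?_)).add measurable_const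
  · refine Measurable.mul ?_ ?_
    · exact (measurable_of_countable fun c : ι → Option (Fin M.D) => M.joinWeight c i).comp hlab
    · exact (Measure.measurable_coe hA).comp (Measure.measurable_dirac.comp (measurable_pi_apply i))
  · refine Measurable.mul ?_ measurable_const
    exact (measurable_of_countable fun c : ι → Option (Fin M.D) => M.freshWeight c j).comp hlab

/-- Normaliser `g`: the number of objects already clustered, plus `α`, plus the total cardinality of
the transitioned clusters. -/
def g (n : ℕ) : ℝ≥0∞ := n + M.α + ∑ j, (M.vstar j : ℝ≥0∞)

lemma sum_joinWeight_add_sum_freshWeight {ι : Type*} [Fintype ι] (c : ι → Option (Fin M.D)) :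
    ∑ i, M.joinWeight c i + ∑ j, M.freshWeight c j
      = Fintype.card ι + ∑ j, (M.vstar j : ℝ≥0∞) := by
  classical
  have h1 : ∀ i, M.joinWeight c i
      = 1 + ∑ j, if c i = some j then (M.vstar j : ℝ≥0∞) / M.occ c j else 0 := by
    intro i
    cases h : c i with
    | none => simp [joinWeight, h]
    | some j =>
      have hpos : (M.occ c j : ℝ≥0∞) ≠ 0 := by
        have : i ∈ Finset.univ.filter fun i => c i = some j := by simp [h]
        exact_mod_cast (Finset.card_pos.2 ⟨i, this⟩).ne'
      simp [joinWeight, h, ENNReal.add_div,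
        ENNReal.div_self hpos (ENNReal.natCast_ne_top _)]
  simp_rw [h1, Finset.sum_add_distrib]
  rw [Finset.sum_comm, add_assoc, ← Finset.sum_add_distrib]
  congr 1
  · simp
  · refine Finset.sum_congr rfl fun j _ => ?_
    rw [← Finset.sum_filter, Finset.sum_const, nsmul_eq_mul]
    change (M.occ c j : ℝ≥0∞) * _ + _ = _
    by_cases h : M.occ c j = 0
    · simp [freshWeight, h]
    · rw [ENNReal.mul_div_cancel (by exact_mod_cast h) (ENNReal.natCast_ne_top _)]
      simp [freshWeight, h]

lemma urnMeasure_univ {ι : Type*} [Fintype ι] (s : ι → M.Atom) :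
    M.urnMeasure s Set.univ = M.g (Fintype.card ι) := by
  have h := M.sum_joinWeight_add_sum_freshWeight fun i => (s i).2
  simp only [urnMeasure, Measure.add_apply, Measure.finsetSum_apply, Measure.smul_apply,
    smul_eq_mul, measure_univ, mul_one, g]
  rw [h]
  ring

lemma g_ne_zero (n : ℕ) : M.g n ≠ 0 := by
  have := M.α_pos.ne'
  simp [g, this]

lemma g_ne_top (n : ℕ) : M.g n ≠ ∞ := by
  simp [g, ENNReal.sum_eq_top]

/-- Law of the (parameter, assignment) of the next object given those of the first `n` objects. -/
def predictive (n : ℕ) : Kernel (M.State n) M.Atom where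
  toFun s := (M.g n)⁻¹ • M.urnMeasure s
  measurable' := by
    refine Measure.measurable_of_measurable_coe _ fun A hA => ?_
    simp only [Measure.smul_apply, smul_eq_mul]
    exact ((Measure.measurable_coe hA).comp M.measurable_urnMeasure).const_mul _

instance (n : ℕ) : IsMarkovKernel (M.predictive n) where
  isProbabilityMeasure s := ⟨by
    change (M.g n)⁻¹ * M.urnMeasure s Set.univ = 1
    rw [urnMeasure_univ, Fintype.card_fin]
    exact ENNReal.inv_mul_cancel (M.g_ne_zero n) (M.g_ne_top n)⟩

lemma measurable_snoc (n : ℕ) :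
    Measurable fun p : M.State n × M.Atom => (Fin.snoc p.1 p.2 : M.State (n + 1)) := by
  refine measurable_pi_lambda _ fun i => ?_
  refine Fin.lastCases ?_ (fun i => ?_) i
  · simpa using measurable_snd
  · simp only [Fin.snoc_castSucc]
    exact (measurable_pi_apply i).comp measurable_fst

/-- The prior: the joint law of the parameters and assignments of `N` objects, which are clustered
one after the other. -/
def prior : (N : ℕ) → Measure (M.State N)
  | 0 => Measure.dirac Fin.elim0
  | n + 1 => ((prior n) ⊗ₘ (M.predictive n)).map
      fun p => (Fin.snoc p.1 p.2 : M.State (n + 1))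

instance (N : ℕ) : IsProbabilityMeasure (M.prior N) := by
  induction N with
  | zero => rw [prior]; infer_instance
  | succ n ih => rw [prior]; exact Measure.isProbabilityMeasure_map (M.measurable_snoc n).aemeasurable

/-! ### The posterior -/

variable {N : ℕ} (x : Fin N → 𝓧) (z : Fin N → 𝓩)

/-- Likelihood of the parameter of object `ℓ`, with object state `x ℓ` and measurement `z ℓ`. -/
def lik (ℓ : Fin N) (θ : Θ) : ℝ≥0∞ := M.R θ (x ℓ) (z ℓ)

lemma measurable_lik (ℓ : Fin N) : Measurable (M.lik x z ℓ) :=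
  measurable_coe_nnreal_ennreal.comp (M.measurable_R (x ℓ) (z ℓ))

/-- Joint likelihood of the measurements, which are independent given the parameters. -/
def jointLik (s : M.State N) : ℝ≥0∞ := ∏ ℓ, M.lik x z ℓ (s ℓ).1

/-- Marginal likelihood of the measurements. -/
def evidence : ℝ≥0∞ := ∫⁻ s, M.jointLik x z s ∂(M.prior N)

/-- The posterior of the parameters and assignments given the measurements, by Bayes' rule. -/
def posterior : Measure (M.State N) :=
  (M.evidence x z)⁻¹ • (M.prior N).withDensity (M.jointLik x z)

instance : IsFiniteMeasure (M.posterior x z) where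
  measure_univ_lt_top := by
    simp only [posterior, Measure.smul_apply, smul_eq_mul, withDensity_apply _ MeasurableSet.univ,
      Measure.restrict_univ]
    exact (ENNReal.inv_mul_le_one _).trans_lt ENNReal.one_lt_top

/-! ### The Gibbs sampler -/

/-- Unnormalised full conditional of object `ℓ` given the other objects and the measurements: the
likelihood of `z ℓ` times the prior conditional. It is a mixture of point masses at the parameters
`θ` of the other objects (weights proportional to `(v + v*) R(z ℓ | θ, x ℓ)` per cluster), of
`R(z ℓ | θ, x ℓ) φ(θ*_j, dθ)` with weight `v*_j` for each transitioned cluster `j` not occupied by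
the other objects, and of `R(z ℓ | θ, x ℓ) H(dθ)` with weight `α`. -/
def gibbsMeasure (ℓ : Fin N) (s : M.State N) : Measure M.Atom :=
  (M.urnMeasure fun i : {i : Fin N // i ≠ ℓ} => s i).withDensity fun a => M.lik x z ℓ a.1

lemma measurable_gibbsMeasure (ℓ : Fin N) : Measurable (M.gibbsMeasure x z ℓ) := by
  refine Measure.measurable_of_measurable_coe _ fun A hA => ?_
  simp only [gibbsMeasure, withDensity_apply _ hA]
  simp only [← lintegral_indicator hA]
  have hf : Measurable (A.indicator fun a : M.Atom => M.lik x z ℓ a.1) :=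
    ((M.measurable_lik x z ℓ).comp measurable_fst).indicator hA
  have hs : Measurable fun (s : M.State N) (i : {i : Fin N // i ≠ ℓ}) => s i := by fun_prop
  exact (Measure.measurable_lintegral hf).comp (M.measurable_urnMeasure.comp hs)

/-- The full conditional law of the (parameter, assignment) of object `ℓ`. -/
def gibbsCond (ℓ : Fin N) : Kernel (M.State N) M.Atom where
  toFun s := (M.gibbsMeasure x z ℓ s Set.univ)⁻¹ • M.gibbsMeasure x z ℓ s
  measurable' := by
    refine Measure.measurable_of_measurable_coe _ fun A hA => ?_
    simp only [Measure.smul_apply, smul_eq_mul]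
    exact ((Measure.measurable_coe MeasurableSet.univ).comp
      (M.measurable_gibbsMeasure x z ℓ)).inv.mul
        ((Measure.measurable_coe hA).comp (M.measurable_gibbsMeasure x z ℓ))

instance (ℓ : Fin N) : IsFiniteKernel (M.gibbsCond x z ℓ) where
  exists_univ_le := ⟨1, ENNReal.one_lt_top, fun _ => ENNReal.inv_mul_le_one _⟩

/-- One Gibbs update: redraw the (parameter, assignment) of object `ℓ` from its full conditional
and keep all the others. -/
def gibbsUpdate (ℓ : Fin N) : Kernel (M.State N) (M.State N) :=
  (Kernel.id ×ₖ M.gibbsCond x z ℓ).map fun p => Function.update p.1 ℓ p.2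

instance (ℓ : Fin N) : IsFiniteKernel (M.gibbsUpdate x z ℓ) := by
  unfold gibbsUpdate; infer_instance

lemma gibbsUpdate_apply (ℓ : Fin N) (s : M.State N) :
    M.gibbsUpdate x z ℓ s = (M.gibbsCond x z ℓ s).map (Function.update s ℓ) := by
  rw [gibbsUpdate, Kernel.map_apply _ measurable_update', Kernel.prod_apply, Kernel.id_apply,
    Measure.dirac_prod, Measure.map_map measurable_update' measurable_prodMk_left]
  rfl

/-- One iteration of the Gibbs sampler: the objects `0, 1, …, N - 1` are updated in turn. -/
def gibbsSweep : Kernel (M.State N) (M.State N) :=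
  (List.finRange N).foldl (fun κ ℓ => M.gibbsUpdate x z ℓ ∘ₖ κ) Kernel.id

instance : IsFiniteKernel (M.gibbsSweep x z) := by
  unfold gibbsSweep
  suffices h : ∀ (l : List (Fin N)) (κ : Kernel (M.State N) (M.State N)), IsFiniteKernel κ →
      IsFiniteKernel (l.foldl (fun κ ℓ => M.gibbsUpdate x z ℓ ∘ₖ κ) κ) from h _ _ inferInstance
  intro l
  induction l with
  | nil => intro κ h; exact h
  | cons a l ih => intro κ h; exact ih _ inferInstance

/-- The transition kernel of the Gibbs sampler after `n` iterations. -/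
def Ψ (n : ℕ) : Kernel (M.State N) (M.State N) := M.gibbsSweep x z ^ n

instance (n : ℕ) : IsFiniteKernel (M.Ψ x z n) := by
  unfold Ψ
  induction n with
  | zero => rw [pow_zero]; exact inferInstanceAs (IsFiniteKernel Kernel.id)
  | succ n ih =>
    rw [pow_succ]
    exact inferInstanceAs (IsFiniteKernel ((M.gibbsSweep x z ^ n) ∘ₖ M.gibbsSweep x z))

/-- The cluster parameters of the objects. -/
def params (s : M.State N) : Fin N → Θ := fun ℓ => (s ℓ).1

end DDPModel

/-- Total variation norm `‖μ - ν‖` of the difference of two finite measures. -/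
def tvNorm {Ω : Type*} [MeasurableSpace Ω] (μ ν : Measure Ω) [IsFiniteMeasure μ]
    [IsFiniteMeasure ν] : ℝ≥0∞ :=
  (μ.toSignedMeasure - ν.toSignedMeasure).totalVariation Set.univ

end

/-! The sampler is a Markov kernel `K` with invariant probability `G`, the posterior, and the
convergence is a coupling argument without coupled chains. On sets `B` carrying all but an
arbitrarily small part of `G`, one step of `K` dominates a fixed nonzero measure
(`exhaustedBySmallSets_gibbsSweep`). If two measures of equal mass are both at most `c • G`, then
most of their mass sits on such a `B`, so one step gives them a common part of fixed size. Because
`G` is invariant, what remains is again at most `c • G`, and the step can be repeated until little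
is left (`exists_overlapWithin_of_le_smul`). Truncating densities extends this to every finite `μ ≪
G` (`eventually_overlapWithin`).

A point mass need not be absolutely continuous. In `ae_forall_eventually_overlapWithin` the kernel
is split as `L + 1_B ⊗ ν`, and the mass of `L ^ n` is the part of the law not yet regenerated from
`ν`. Its limit `r` is a `K`-harmonic function whose integral vanishes against `ν`, hence against
`G`, hence against any `π` with `K ∘ₘ π ≪ G`. The prior is such a `π`: updates preserve its null
sets, and every updated object has nonzero likelihood.

The model enters in three ways. First, the urn scheme is exchangeable (`measurePreserving_perm`), so
the urn measure built on the other objects is the prior conditional of any object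
(`lintegral_prior_insertNth`); this yields invariance. Second, with positive prior probability all
objects open new clusters with nonzero likelihood; hence the evidence is positive and, where it is
finite, so is every normaliser. Third, where the likelihoods are bounded, so are the normalisers,
and each object may open a new cluster with a weight bounded below; this yields the small sets. -/

/-! ### Overlap of measures and total variation -/

/-- Two measures share a common part up to remainders of mass at most `ε`. -/
def OverlapWithin {X : Type*} [MeasurableSpace X] (ε : ℝ≥0∞) (μ ν : Measure X) : Prop :=
  ∃ ρ p q : Measure X, μ = ρ + p ∧ ν = ρ + q ∧ p Set.univ ≤ ε ∧ q Set.univ ≤ ε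

lemma MeasureTheory.Measure.smul_le_smul_of_le {X : Type*} [MeasurableSpace X] {a b : ℝ≥0∞}
    (h : a ≤ b) (μ : Measure X) : a • μ ≤ b • μ :=
  fun A => mul_le_mul_left h (μ A)

namespace OverlapWithin

variable {X Y : Type*} [MeasurableSpace X] [MeasurableSpace Y] {ε : ℝ≥0∞} {μ ν : Measure X}

lemma map (h : OverlapWithin ε μ ν) {f : X → Y} (hf : Measurable f) :
    OverlapWithin ε (μ.map f) (ν.map f) := by
  obtain ⟨ρ, p, q, rfl, rfl, hp, hq⟩ := h
  refine ⟨ρ.map f, p.map f, q.map f, Measure.map_add _ _ hf, Measure.map_add _ _ hf, ?_, ?_⟩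
  all_goals rwa [Measure.map_apply hf MeasurableSet.univ, Set.preimage_univ]

lemma bind (h : OverlapWithin ε μ ν) (K : Kernel X Y) [IsMarkovKernel K] :
    OverlapWithin ε (K ∘ₘ μ) (K ∘ₘ ν) := by
  obtain ⟨ρ, p, q, rfl, rfl, hp, hq⟩ := h
  refine ⟨K ∘ₘ ρ, K ∘ₘ p, K ∘ₘ q, Measure.comp_add, Measure.comp_add, ?_, ?_⟩
  all_goals simpa [Measure.bind_apply MeasurableSet.univ K.aemeasurable]

lemma add (h : OverlapWithin ε μ ν) {δ : ℝ≥0∞} {μ' ν' : Measure X} (hμ : μ' Set.univ ≤ δ)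
    (hν : ν' Set.univ ≤ δ) : OverlapWithin (ε + δ) (μ + μ') (ν + ν') := by
  obtain ⟨ρ, p, q, rfl, rfl, hp, hq⟩ := h
  exact ⟨ρ, p + μ', q + ν', add_assoc _ _ _, add_assoc _ _ _, add_le_add hp hμ, add_le_add hq hν⟩

end OverlapWithin

/-- On a Hahn set `i` the positive part has mass `p i - q i`, at most the mass of `p`; the
complement bounds the negative part by the mass of `q`. -/
lemma totalVariation_sub_le {X : Type*} [MeasurableSpace X] (p q : Measure X)
    [IsFiniteMeasure p] [IsFiniteMeasure q] :
    (p.toSignedMeasure - q.toSignedMeasure).totalVariation Set.univ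
      ≤ p Set.univ + q Set.univ := by
  set s := p.toSignedMeasure - q.toSignedMeasure with hs
  obtain ⟨i, hi, hi₁, hi₂, hpos, hneg⟩ := s.toJordanDecomposition_spec
  rw [SignedMeasure.totalVariation, Measure.add_apply, hpos, hneg]
  have key : ∀ A, MeasurableSet A → s A = p.real A - q.real A := fun A hA => by
    rw [hs, Measure.toSignedMeasure_sub_apply hA]
  refine add_le_add ?_ ?_
  · rw [SignedMeasure.toMeasureOfZeroLE_apply _ hi₁ hi MeasurableSet.univ]
    have h : s (i ∩ Set.univ) ≤ p.real Set.univ := by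
      rw [Set.inter_univ, key i hi]
      have := measureReal_mono (μ := p) (Set.subset_univ i)
      have := measureReal_nonneg (μ := q) (s := i)
      linarith
    rw [← ofReal_measureReal (μ := p), ENNReal.ofReal]
    exact ENNReal.coe_le_coe.2 (NNReal.coe_le_coe.1 (by rwa [Real.coe_toNNReal _ measureReal_nonneg]))
  · rw [SignedMeasure.toMeasureOfLEZero_apply _ hi₂ hi.compl MeasurableSet.univ]
    have h : -s (iᶜ ∩ Set.univ) ≤ q.real Set.univ := by
      rw [Set.inter_univ, key _ hi.compl]
      have := measureReal_mono (μ := q) (Set.subset_univ iᶜ)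
      have := measureReal_nonneg (μ := p) (s := iᶜ)
      linarith
    rw [← ofReal_measureReal (μ := q), ENNReal.ofReal]
    exact ENNReal.coe_le_coe.2 (NNReal.coe_le_coe.1 (by rwa [Real.coe_toNNReal _ measureReal_nonneg]))

/-- The common part cancels in the difference, and only the two remainders count. -/
lemma OverlapWithin.tvNorm_le {X : Type*} [MeasurableSpace X] {ε : ℝ≥0∞} {μ ν : Measure X}
    [IsFiniteMeasure μ] [IsFiniteMeasure ν] (h : OverlapWithin ε μ ν) :
    tvNorm μ ν ≤ ε + ε := by
  obtain ⟨ρ, p, q, hμ, hν, hp, hq⟩ := h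
  have : IsFiniteMeasure ρ := isFiniteMeasure_of_le μ (hμ ▸ Measure.le_add_right le_rfl)
  have : IsFiniteMeasure p := isFiniteMeasure_of_le μ (hμ ▸ Measure.le_add_left le_rfl)
  have : IsFiniteMeasure q := isFiniteMeasure_of_le ν (hν ▸ Measure.le_add_left le_rfl)
  have e : μ.toSignedMeasure - ν.toSignedMeasure = p.toSignedMeasure - q.toSignedMeasure := by
    subst hμ hν
    rw [Measure.toSignedMeasure_add, Measure.toSignedMeasure_add]
    abel
  rw [tvNorm, e]
  exact (totalVariation_sub_le p q).trans (add_le_add hp hq)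

/-! ### Convergence of Markov kernels exhausted by small sets -/

namespace ProbabilityTheory.Kernel

variable {X : Type*} [MeasurableSpace X]

instance isMarkovKernel_pow (K : Kernel X X) [IsMarkovKernel K] (n : ℕ) :
    IsMarkovKernel (K ^ n) := by
  induction n with
  | zero => rw [pow_zero]; exact inferInstanceAs (IsMarkovKernel Kernel.id)
  | succ n ih =>
    rw [pow_succ]
    exact inferInstanceAs (IsMarkovKernel ((K ^ n) ∘ₖ K))

lemma pow_add_comp_measure (K : Kernel X X) (m n : ℕ) (μ : Measure X) :
    (K ^ (m + n)) ∘ₘ μ = (K ^ m) ∘ₘ ((K ^ n) ∘ₘ μ) := by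
  rw [Measure.comp_assoc, pow_add]

lemma comp_measure_univ {Y : Type*} [MeasurableSpace Y] (K : Kernel X Y) [IsMarkovKernel K]
    (μ : Measure X) : (K ∘ₘ μ) Set.univ = μ Set.univ := by
  simp [Measure.bind_apply MeasurableSet.univ K.aemeasurable]

lemma pow_zero_comp_measure (K : Kernel X X) (μ : Measure X) :
    (K ^ 0 : Kernel X X) ∘ₘ μ = μ := by
  rw [pow_zero]; exact Measure.id_comp

lemma comp_measure_mono {Y : Type*} [MeasurableSpace Y] (K : Kernel X Y) {μ ν : Measure X}
    (h : μ ≤ ν) : K ∘ₘ μ ≤ K ∘ₘ ν := by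
  refine Measure.le_iff.2 fun A hA => ?_
  rw [Measure.bind_apply hA K.aemeasurable, Measure.bind_apply hA K.aemeasurable]
  exact lintegral_mono' h le_rfl

/-- If a kernel dominates `ν` from every point of `B`, then it moves `μ` to at least `μ B • ν`. -/
lemma smul_le_comp_of_le {Y : Type*} [MeasurableSpace Y] (K : Kernel X Y) {B : Set X}
    (hB : MeasurableSet B) {ν : Measure Y} (hν : ∀ s ∈ B, ν ≤ K s) (μ : Measure X) :
    μ B • ν ≤ K ∘ₘ μ := by
  refine Measure.le_iff.2 fun A hA => ?_
  rw [Measure.bind_apply hA K.aemeasurable, Measure.smul_apply, smul_eq_mul, mul_comm,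
    ← MeasureTheory.setLIntegral_const]
  exact (setLIntegral_mono' hB fun s hs => hν s hs A).trans (setLIntegral_le_lintegral _ _)

lemma invariant_pow {K : Kernel X X} {G : Measure X} (hG : K.Invariant G) (n : ℕ) : (K ^ n) ∘ₘ G = G := by
  induction n with
  | zero => exact pow_zero_comp_measure K G
  | succ n ih => rw [pow_add_comp_measure, pow_one, hG.def, ih]

variable {K : Kernel X X} [IsMarkovKernel K] {G : Measure X} [IsProbabilityMeasure G]

/-- The state space is exhausted, up to sets of small `G`-measure, by sets on which the kernel
dominates a fixed nonzero measure. -/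
def ExhaustedBySmallSets (K : Kernel X X) (G : Measure X) : Prop :=
  ∀ η : ℝ≥0∞, η ≠ 0 → ∃ B, MeasurableSet B ∧ G Bᶜ ≤ η ∧
    ∃ ν : Measure X, ν Set.univ ≠ 0 ∧ ∀ s ∈ B, ν ≤ K s

/-- One step of the kernel merges a fixed mass of any two measures of equal, not too small mass that
are dominated by `c • G`. -/
lemma exists_mass_removed (hG : K.Invariant G) (hK : ExhaustedBySmallSets K G)
    {c a : ℝ≥0∞} (hc : c ≠ ∞) (ha : a ≠ 0) :
    ∃ κ : ℝ≥0∞, κ ≠ 0 ∧ ∀ p q : Measure X, p ≤ c • G → q ≤ c • G → p Set.univ = q Set.univ →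
      a ≤ p Set.univ → ∃ ρ p' q' : Measure X, p' ≤ c • G ∧ q' ≤ c • G ∧
        p' Set.univ = q' Set.univ ∧ p' Set.univ + κ = p Set.univ ∧
        K ∘ₘ p = ρ + p' ∧ K ∘ₘ q = ρ + q' := by
  -- The level is chosen so that a measure below `c • G` has mass at most `a / 2` off `B`, hence at
  -- least `a / 2` on `B` when its total mass is at least `a`.
  obtain ⟨B, hB, hGB, ν, hν, hνK⟩ := hK (a / 2 / c)
    (ENNReal.div_ne_zero.2 ⟨(ENNReal.half_pos ha).ne', hc⟩)
  refine ⟨a / 2 * ν Set.univ, mul_ne_zero (ENNReal.half_pos ha).ne' hν,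
    fun p q hp hq hpq hap => ?_⟩
  have hfin : IsFiniteMeasure (c • G) := G.smul_finite hc
  have hpf : IsFiniteMeasure p := isFiniteMeasure_of_le _ hp
  have hqf : IsFiniteMeasure q := isFiniteMeasure_of_le _ hq
  have ha' : a ≠ ∞ := (hap.trans_lt (measure_lt_top p _)).ne
  have hmass : ∀ r : Measure X, r ≤ c • G → a ≤ r Set.univ → a / 2 ≤ r B := fun r hr har => by
    have h1 : r Bᶜ ≤ a / 2 := calc
      r Bᶜ ≤ c * G Bᶜ := hr _
      _ ≤ c * (a / 2 / c) := by gcongr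
      _ ≤ a / 2 := ENNReal.mul_div_le
    have h2 : a / 2 + a / 2 ≤ r B + a / 2 := by
      rw [ENNReal.add_halves]
      exact har.trans ((measure_add_measure_compl hB).symm.le.trans (by gcongr))
    exact (ENNReal.add_le_add_iff_right (ENNReal.div_ne_top ha' two_ne_zero)).1 h2
  have hBne : B.Nonempty := by
    by_contra hne
    have := hmass p hp hap
    rw [Set.not_nonempty_iff_eq_empty.1 hne, measure_empty, nonpos_iff_eq_zero] at this
    exact (ENNReal.half_pos ha).ne' this
  have hνf : IsFiniteMeasure ν := isFiniteMeasure_of_le _ (hνK _ hBne.some_mem)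
  have hρf : IsFiniteMeasure ((a / 2) • ν) := ν.smul_finite (ENNReal.div_ne_top ha' two_ne_zero)
  have hle : ∀ r : Measure X, r ≤ c • G → a ≤ r Set.univ → (a / 2) • ν ≤ K ∘ₘ r :=
    fun r hr har => (Measure.smul_le_smul_of_le (hmass r hr har) ν).trans
      (smul_le_comp_of_le K hB hνK r)
  -- Invariance keeps the same constant `c` for the remainders, so that the step can be iterated
  -- with the same `κ`.
  have hdom : ∀ r : Measure X, r ≤ c • G → K ∘ₘ r - (a / 2) • ν ≤ c • G := fun r hr =>
    Measure.sub_le.trans ((comp_measure_mono K hr).trans (by rw [Measure.comp_smul, hG.def]))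
  have hp1 := Measure.sub_add_cancel_of_le (hle p hp hap)
  have hq1 := Measure.sub_add_cancel_of_le (hle q hq (hpq ▸ hap))
  have hpm : (K ∘ₘ p - (a / 2) • ν) Set.univ + a / 2 * ν Set.univ = p Set.univ := by
    rw [← comp_measure_univ K p]
    exact congrArg (fun m : Measure X => m Set.univ) hp1
  have hqm : (K ∘ₘ q - (a / 2) • ν) Set.univ + a / 2 * ν Set.univ = q Set.univ := by
    rw [← comp_measure_univ K q]
    exact congrArg (fun m : Measure X => m Set.univ) hq1
  refine ⟨(a / 2) • ν, _, _, hdom p hp, hdom q hq, ?_, hpm, ?_, ?_⟩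
  · have := hpm.trans (hpq.trans hqm.symm)
    exact (ENNReal.add_left_inj (measure_ne_top ((a / 2) • ν) Set.univ)).1 this
  · rw [add_comm, hp1]
  · rw [add_comm, hq1]

/-- While the unmatched mass exceeds `a`, each step removes the same amount `κ`. As the mass is
finite, this stops; the induction is on the number of multiples of `κ` that cover it. -/
lemma exists_overlapWithin_of_le_smul (hG : K.Invariant G) (hK : ExhaustedBySmallSets K G)
    {c a : ℝ≥0∞} (hc : c ≠ ∞) (ha : a ≠ 0) {p q : Measure X} (hp : p ≤ c • G) (hq : q ≤ c • G)
    (hpq : p Set.univ = q Set.univ) :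
    ∃ n : ℕ, OverlapWithin a ((K ^ n : Kernel X X) ∘ₘ p) ((K ^ n : Kernel X X) ∘ₘ q) := by
  obtain ⟨κ, hκ, hstep⟩ := exists_mass_removed hG hK hc ha
  have hfin : IsFiniteMeasure (c • G) := G.smul_finite hc
  have main : ∀ (k : ℕ) (p q : Measure X), p ≤ c • G → q ≤ c • G → p Set.univ = q Set.univ →
      p Set.univ ≤ k * κ → ∃ n : ℕ, OverlapWithin a ((K ^ n : Kernel X X) ∘ₘ p) ((K ^ n : Kernel X X) ∘ₘ q) := by
    intro k
    induction k with
    | zero =>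
      intro p q hp hq hpq hk
      have h0 : p Set.univ = 0 := by simpa using hk
      refine ⟨0, 0, p, q, ?_, ?_, ?_, ?_⟩
      · rw [pow_zero_comp_measure, zero_add]
      · rw [pow_zero_comp_measure, zero_add]
      · simp [h0]
      · simp [← hpq, h0]
    | succ k ih =>
      intro p q hp hq hpq hk
      have hpf : IsFiniteMeasure p := isFiniteMeasure_of_le _ hp
      by_cases hle : p Set.univ ≤ a
      · refine ⟨0, 0, p, q, ?_, ?_, hle, hpq ▸ hle⟩
        · rw [pow_zero_comp_measure, zero_add]
        · rw [pow_zero_comp_measure, zero_add]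
      obtain ⟨ρ, p', q', hp', hq', hpq', hm, hKp, hKq⟩ := hstep p q hp hq hpq (not_le.1 hle).le
      have hκt : κ ≠ ∞ := fun h => measure_ne_top p Set.univ (by rw [← hm, h, add_top])
      obtain ⟨n, ρ', p'', q'', h1, h2, h3, h4⟩ := ih p' q' hp' hq' hpq' (by
        rw [← hm, Nat.cast_add, add_mul, Nat.cast_one, one_mul] at hk
        exact (ENNReal.add_le_add_iff_right hκt).1 hk)
      refine ⟨n + 1, (K ^ n) ∘ₘ ρ + ρ', p'', q'', ?_, ?_, h3, h4⟩
      · rw [pow_add_comp_measure, pow_one, hKp, Measure.comp_add, h1, add_assoc]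
      · rw [pow_add_comp_measure, pow_one, hKq, Measure.comp_add, h2, add_assoc]
  have hpf : IsFiniteMeasure p := isFiniteMeasure_of_le _ hp
  obtain ⟨k, hk⟩ := ENNReal.exists_nat_mul_gt hκ (measure_ne_top p Set.univ)
  exact main k p q hp hq hpq hk.le

/-- A measure `μ ≪ G` is dominated by a multiple of `G` up to a part of small mass. -/
lemma _root_.MeasureTheory.Measure.AbsolutelyContinuous.exists_eq_add_le_smul {μ : Measure X}
    [IsFiniteMeasure μ] (h : μ ≪ G) {ε : ℝ≥0∞} (hε : ε ≠ 0) :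
    ∃ (c : ℝ≥0∞) (p r : Measure X), c ≠ ∞ ∧ μ = p + r ∧ p ≤ c • G ∧ r Set.univ ≤ ε := by
  set f := μ.rnDeriv G with hf
  have hfm : Measurable f := Measure.measurable_rnDeriv μ G
  have hμ : G.withDensity f = μ := Measure.withDensity_rnDeriv_eq μ G h
  have hmeas : ∀ n : ℕ, MeasurableSet {x | (n : ℝ≥0∞) < f x} := fun n =>
    measurableSet_lt measurable_const hfm
  have hlim : Tendsto (fun n : ℕ => μ {x | (n : ℝ≥0∞) < f x}) atTop
      (𝓝 (μ (⋂ n : ℕ, {x | (n : ℝ≥0∞) < f x}))) := by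
    refine tendsto_measure_iInter_atTop (fun n => (hmeas n).nullMeasurableSet) ?_
      ⟨0, measure_ne_top _ _⟩
    intro m n hmn x hx
    exact lt_of_le_of_lt (Nat.cast_le.2 hmn : (m : ℝ≥0∞) ≤ n) hx
  -- The intersection lies in the set where the density is infinite, which is `G`-null and so
  -- `μ`-null.
  have hzero : μ (⋂ n : ℕ, {x | (n : ℝ≥0∞) < f x}) = 0 := by
    refine h (measure_mono_null ?_ (measure_eq_zero_iff_ae_notMem.2 ?_ :
      G {x | f x = ∞} = 0))
    · intro x hx
      rw [Set.mem_iInter] at hx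
      exact ENNReal.eq_top_of_forall_nnreal_le fun r => by
        obtain ⟨n, hn⟩ := exists_nat_ge r
        exact le_trans (by exact_mod_cast hn) (le_of_lt (hx n))
    · filter_upwards [Measure.rnDeriv_lt_top μ G] with x hx using hx.ne
  rw [hzero] at hlim
  obtain ⟨n, hn⟩ := (hlim.eventually (gt_mem_nhds (pos_iff_ne_zero.2 hε))).exists
  refine ⟨n, μ.restrict {x | (n : ℝ≥0∞) < f x}ᶜ, μ.restrict {x | (n : ℝ≥0∞) < f x},
    ENNReal.natCast_ne_top n, ?_, ?_, ?_⟩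
  · rw [add_comm, Measure.restrict_add_restrict_compl (hmeas n)]
  · refine Measure.le_iff.2 fun A hA => ?_
    rw [Measure.restrict_apply hA, ← hμ, withDensity_apply _ (hA.inter (hmeas n).compl),
      Measure.smul_apply, smul_eq_mul]
    calc ∫⁻ x in A ∩ {x | (n : ℝ≥0∞) < f x}ᶜ, f x ∂G
        ≤ ∫⁻ x in A ∩ {x | (n : ℝ≥0∞) < f x}ᶜ, n ∂G :=
          setLIntegral_mono' (hA.inter (hmeas n).compl) fun x hx => not_lt.1 hx.2
      _ = n * G (A ∩ {x | (n : ℝ≥0∞) < f x}ᶜ) := MeasureTheory.setLIntegral_const _ _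
      _ ≤ n * G A := by gcongr; exact Set.inter_subset_left
  · rw [Measure.restrict_apply_univ]; exact hn.le

/-- Asymptotic stability: the iterates of a finite measure `μ ≪ G` approach a multiple of `G`. -/
lemma eventually_overlapWithin (hG : K.Invariant G) (hK : ExhaustedBySmallSets K G)
    {μ : Measure X} [IsFiniteMeasure μ] (h : μ ≪ G) {ε : ℝ≥0∞} (hε : ε ≠ 0) :
    ∀ᶠ n in atTop, OverlapWithin ε ((K ^ n : Kernel X X) ∘ₘ μ) (μ Set.univ • G) := by
  have hε2 : ε / 2 ≠ 0 := (ENNReal.half_pos hε).ne'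
  obtain ⟨c, p, r, hc, rfl, hp, hr⟩ := h.exists_eq_add_le_smul hε2
  have hpf : IsFiniteMeasure p := isFiniteMeasure_of_le _ (Measure.le_add_right (le_refl p) : p ≤ p + r)
  have hpc : p Set.univ ≤ c := by simpa using hp Set.univ
  -- The partner of `p` is the multiple of `G` with the same mass. It is also below `c • G`, and the
  -- kernel leaves it fixed.
  obtain ⟨n₀, hn₀⟩ := exists_overlapWithin_of_le_smul hG hK hc hε2 hp
    (Measure.smul_le_smul_of_le hpc G) (by simp)
  refine eventually_atTop.2 ⟨n₀, fun n hn => ?_⟩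
  obtain ⟨k, rfl⟩ := Nat.exists_eq_add_of_le' hn
  rw [Measure.comp_add, Measure.add_apply, add_smul, ← ENNReal.add_halves ε]
  refine OverlapWithin.add ?_ ?_ ?_
  · have := hn₀.bind (K ^ k)
    rwa [← pow_add_comp_measure, ← pow_add_comp_measure, Measure.comp_smul,
      invariant_pow hG] at this
  · rwa [comp_measure_univ]
  · simpa using hr


/-- A kernel that dominates `ν` from every point of `B` splits off the kernel `1_B • ν`. -/
lemma exists_eq_add_of_le_on {Y : Type*} [MeasurableSpace Y] (K : Kernel X Y) {B : Set X}
    (hB : MeasurableSet B) {ν : Measure Y} [IsFiniteMeasure ν] (hν : ∀ s ∈ B, ν ≤ K s) :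
    ∃ L : Kernel X Y, ∀ μ : Measure X, K ∘ₘ μ = L ∘ₘ μ + μ B • ν := by
  classical
  have hle : ∀ s, B.indicator (fun _ => ν) s ≤ K s := fun s => by
    by_cases h : s ∈ B
    · rw [Set.indicator_of_mem h]; exact hν s h
    · rw [Set.indicator_of_notMem h]; exact Measure.zero_le _
  have hfin : ∀ s, IsFiniteMeasure (B.indicator (fun _ => ν) s) := fun s => by
    by_cases h : s ∈ B
    · rw [Set.indicator_of_mem h]; infer_instance
    · rw [Set.indicator_of_notMem h]; infer_instance
  have happ : ∀ s A, B.indicator (fun _ => ν) s A = B.indicator (fun _ => ν A) s := fun s A => by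
    by_cases h : s ∈ B <;> simp [h]
  let L : Kernel X Y :=
    { toFun := fun s => K s - B.indicator (fun _ => ν) s
      measurable' := by
        refine Measure.measurable_of_measurable_coe _ fun A hA => ?_
        simp_rw [Measure.sub_apply hA (hle _), happ]
        exact (K.measurable_coe hA).sub (measurable_const.indicator hB) }
  refine ⟨L, fun μ => Measure.ext fun A hA => ?_⟩
  have hL : ∀ s, K s A = L s A + B.indicator (fun _ => ν A) s := fun s => by
    rw [← happ]
    exact congrArg (fun m : Measure Y => m A) (Measure.sub_add_cancel_of_le (hle s)).symm
  rw [Measure.add_apply, Measure.bind_apply hA K.aemeasurable, Measure.bind_apply hA L.aemeasurable,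
    lintegral_congr hL, lintegral_add_left (L.measurable_coe hA), lintegral_indicator hB,
    MeasureTheory.setLIntegral_const, Measure.smul_apply, smul_eq_mul, mul_comm]

/-- Convergence from almost every initial state, for a Markov kernel with an invariant probability
measure `G` that is exhausted by small sets. The initial states are taken with respect to any
measure that the kernel moves into the measures absolutely continuous with respect to `G`. -/
theorem ae_forall_eventually_overlapWithin (hG : K.Invariant G) (hK : ExhaustedBySmallSets K G)
    {π : Measure X} (hπ : K ∘ₘ π ≪ G) :
    ∀ᵐ s ∂π, ∀ ε : ℝ≥0∞, ε ≠ 0 → ∀ᶠ n in atTop, OverlapWithin ε ((K ^ n : Kernel X X) s) G := by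
  -- Any level below `1` would do: only `G B ≠ 0` is needed.
  obtain ⟨B, hB, hGB, ν, hν, hνK⟩ := hK (1 / 2) (by simp)
  have hGB0 : G B ≠ 0 := fun h => by
    have h1 := prob_compl_eq_one_sub (μ := G) hB
    rw [h, tsub_zero] at h1
    rw [h1] at hGB
    exact absurd hGB (not_le.2 (by simp))
  have hBne : B.Nonempty := nonempty_of_measure_ne_zero hGB0
  have hνf : IsFiniteMeasure ν := isFiniteMeasure_of_le _ (hνK _ hBne.some_mem)
  have hνG : ν ≪ G := by
    refine (Measure.absolutelyContinuous_smul hGB0).trans (Measure.absolutelyContinuous_of_le ?_)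
    exact (smul_le_comp_of_le K hB hνK G).trans hG.def.le
  obtain ⟨L, hL⟩ := exists_eq_add_of_le_on K hB hνK
  have hLK : ∀ μ : Measure X, (L ∘ₘ μ) Set.univ ≤ μ Set.univ := fun μ => by
    rw [← comp_measure_univ K μ, hL μ]
    exact Measure.le_add_right le_rfl _
  have hL1 : ∀ s, L s Set.univ ≤ 1 := fun s => by
    simpa [Measure.dirac_bind L.measurable] using hLK (Measure.dirac s)
  let q : ℕ → X → ℝ≥0∞ := fun n s => (L ^ n : Kernel X X) s Set.univ
  have hqm : ∀ n, Measurable (q n) := fun n => (L ^ n : Kernel X X).measurable_coe MeasurableSet.univ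
  have hq0 : ∀ s, q 0 s = 1 := fun s => by
    change (L ^ 0 : Kernel X X) s Set.univ = 1
    rw [pow_zero]
    exact (congrArg (fun m : Measure X => m Set.univ) (Kernel.id_apply s)).trans measure_univ
  have hqs : ∀ n s, q (n + 1) s = ∫⁻ t, q n t ∂L s := fun n s => by
    change (L ^ (n + 1) : Kernel X X) s Set.univ = _
    rw [pow_succ]
    exact Kernel.comp_apply' _ _ _ MeasurableSet.univ
  have hanti : ∀ n s, q (n + 1) s ≤ q n s := fun n => by
    induction n with
    | zero => intro s; simpa [hqs, hq0] using hL1 s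
    | succ n ih =>
      intro s
      rw [hqs (n + 1), hqs n]
      exact lintegral_mono ih
  -- The mass that never regenerates from `ν`. As a decreasing limit of `q n`, it is harmonic for
  -- `L`.
  let r : X → ℝ≥0∞ := fun s => ⨅ n, q n s
  have hrm : Measurable r := Measurable.iInf hqm
  have hr1 : ∀ s, r s ≤ 1 := fun s => (iInf_le _ 0).trans (hq0 s).le
  have hrL : ∀ s, ∫⁻ t, r t ∂L s = r s := fun s => by
    have hne : ∫⁻ t, q 0 t ∂L s ≠ ∞ := by
      rw [← hqs]
      exact ((hanti 0 s).trans_lt (by simp [hq0])).ne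
    rw [lintegral_iInf hqm (antitone_nat_of_succ_le hanti) hne]
    simp_rw [← hqs]
    exact (antitone_nat_of_succ_le (f := fun n => q n s) fun n => hanti n s).iInf_nat_add 1
  have hrK : ∀ μ : Measure X, ∫⁻ t, r t ∂(K ∘ₘ μ) = ∫⁻ t, r t ∂μ + μ B * ∫⁻ t, r t ∂ν := fun μ => by
    rw [hL, lintegral_add_measure, lintegral_smul_measure, smul_eq_mul,
      Measure.lintegral_bind L.aemeasurable hrm.aemeasurable]
    simp_rw [hrL]
  -- One step of `K` raises the integral of `r` against `G` by `G B * ∫⁻ t, r t ∂ν`, but `G` is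
  -- invariant and the integral is finite.
  have hrν : ∫⁻ t, r t ∂ν = 0 := by
    have h := hrK G
    rw [hG.def] at h
    have hne : ∫⁻ t, r t ∂G ≠ ∞ := by
      refine ((lintegral_mono hr1).trans_lt ?_).ne
      simp
    have h0 : ∫⁻ t, r t ∂G + 0 = ∫⁻ t, r t ∂G + G B * ∫⁻ t, r t ∂ν := by rw [add_zero]; exact h
    exact (mul_eq_zero.1 ((ENNReal.add_right_inj hne).1 h0).symm).resolve_left hGB0
  have hrK' : ∀ μ : Measure X, ∫⁻ t, r t ∂(K ∘ₘ μ) = ∫⁻ t, r t ∂μ := fun μ => by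
    rw [hrK, hrν, mul_zero, add_zero]
  have hrKn : ∀ n : ℕ, ∫⁻ t, r t ∂((K ^ n : Kernel X X) ∘ₘ ν) = 0 := fun n => by
    induction n with
    | zero => rw [pow_zero_comp_measure, hrν]
    | succ n ih => rw [add_comm, pow_add_comp_measure, pow_one, hrK', ih]
  -- The iterates of `ν` all integrate `r` to zero and approach a nonzero multiple of `G`. Their
  -- common part with it contributes nothing, and the remainder of that multiple at most `ε`, since
  -- `r ≤ 1`.
  have hrG : ∫⁻ t, r t ∂G = 0 := by
    have hsmall : ∀ ε : ℝ≥0∞, ε ≠ 0 → ν Set.univ * ∫⁻ t, r t ∂G ≤ ε := fun ε hε => by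
      obtain ⟨n, ρ, p', q', h1, h2, h3, h4⟩ := (eventually_overlapWithin hG hK hνG hε).exists
      have hρ : ∫⁻ t, r t ∂ρ = 0 := by
        have := hrKn n
        rw [h1, lintegral_add_measure] at this
        exact (add_eq_zero.1 this).1
      rw [← smul_eq_mul, ← lintegral_smul_measure, h2, lintegral_add_measure, hρ, zero_add]
      exact (lintegral_mono hr1).trans (by simpa using h4)
    have h0 : ν Set.univ * ∫⁻ t, r t ∂G = 0 := by
      by_contra hne
      have := hsmall _ (ENNReal.half_pos hne).ne'
      refine absurd this (not_le.2 (ENNReal.half_lt_self hne ?_))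
      exact ((hsmall 1 one_ne_zero).trans_lt ENNReal.one_lt_top).ne
    exact (mul_eq_zero.1 h0).resolve_left hν
  have hrπ : ∀ᵐ s ∂π, r s = 0 := by
    refine (lintegral_eq_zero_iff hrm).1 ?_
    rw [← hrK' π]
    exact (lintegral_eq_zero_iff hrm).2 (hπ.ae_le ((lintegral_eq_zero_iff hrm).1 hrG))
  -- Every part that has regenerated from `ν` is absolutely continuous, and `K` preserves this by
  -- invariance of `G`; only `L ^ n` may retain a singular part.
  have hdecomp : ∀ s (n : ℕ), ∃ A : Measure X, A ≪ G ∧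
      (K ^ n : Kernel X X) s = (L ^ n : Kernel X X) s + A := fun s n => by
    induction n with
    | zero => exact ⟨0, Measure.AbsolutelyContinuous.zero G, by rw [pow_zero, pow_zero, add_zero]⟩
    | succ n ih =>
      obtain ⟨A, hA, h⟩ := ih
      refine ⟨(L ^ n : Kernel X X) s B • ν + K ∘ₘ A, ?_, ?_⟩
      · refine Measure.AbsolutelyContinuous.add_left ?_ ?_
        · exact (Measure.smul_absolutelyContinuous).trans hνG
        · have := hA.comp_right K
          rwa [hG.def] at this
      · have h1 : ∀ J : Kernel X X, (J ^ (n + 1) : Kernel X X) s = J ∘ₘ ((J ^ n : Kernel X X) s) :=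
          fun J => by rw [pow_succ']; exact Kernel.comp_apply _ _ _
        rw [h1 K, h1 L, h, Measure.comp_add, hL, add_assoc]
  filter_upwards [hrπ] with s hs ε hε
  have hε2 : ε / 2 ≠ 0 := (ENNReal.half_pos hε).ne'
  obtain ⟨n, hn⟩ := exists_lt_of_ciInf_lt (f := fun n => q n s)
    (hs.trans_lt (pos_iff_ne_zero.2 hε2))
  obtain ⟨A, hA, hKA⟩ := hdecomp s n
  have hAf : IsFiniteMeasure A := isFiniteMeasure_of_le ((K ^ n : Kernel X X) s)
    (hKA ▸ Measure.le_add_left le_rfl)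
  obtain ⟨k₀, hk₀⟩ := eventually_atTop.1 (eventually_overlapWithin hG hK hA hε2)
  refine eventually_atTop.2 ⟨k₀ + n, fun m hm => ?_⟩
  obtain ⟨k, rfl⟩ := Nat.exists_eq_add_of_le' hm
  have hG' : A Set.univ • G + (L ^ n : Kernel X X) s Set.univ • G = G := by
    rw [← add_smul, add_comm, ← Measure.add_apply, ← hKA, measure_univ, one_smul]
  have hKn : (K ^ (k + (k₀ + n)) : Kernel X X) s =
      (K ^ (k + k₀) : Kernel X X) ∘ₘ A + (K ^ (k + k₀) : Kernel X X) ∘ₘ ((L ^ n : Kernel X X) s) := by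
    rw [← Measure.comp_add, add_comm A, ← hKA, ← add_assoc, pow_add]
    exact Kernel.comp_apply _ _ _
  rw [hKn, ← hG', ← ENNReal.add_halves ε]
  refine (hk₀ _ (Nat.le_add_left _ _)).add ?_ ?_
  · rw [comp_measure_univ]; exact hn.le
  · simpa using hn.le

end ProbabilityTheory.Kernel

/-! ### Integration against the urn measure -/

namespace DDPModel

variable {Θ 𝓧 𝓩 : Type*} [MeasurableSpace Θ] (M : DDPModel Θ 𝓧 𝓩)

section Urn

variable {ι : Type*} [Fintype ι]

lemma lintegral_urnMeasure (s : ι → M.Atom) {f : M.Atom → ℝ≥0∞} (hf : Measurable f) :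
    ∫⁻ a, f a ∂M.urnMeasure s = ∑ i, M.joinWeight (fun i' => (s i').2) i * f (s i)
      + ∑ j, M.freshWeight (fun i' => (s i').2) j * ∫⁻ θ, f (θ, some j) ∂M.φ (M.θstar j)
      + M.α * ∫⁻ θ, f (θ, none) ∂M.H := by
  simp only [urnMeasure, lintegral_add_measure, lintegral_finsetSum_measure,
    lintegral_smul_measure, smul_eq_mul, lintegral_dirac' _ hf, Measure.prod_dirac,
    lintegral_map hf measurable_prodMk_right]

/-- Integrals against the urn measure only see the occupied atoms, the unoccupied transitioned
clusters and the new clusters. -/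
lemma lintegral_urnMeasure_congr (s : ι → M.Atom) {f f' : M.Atom → ℝ≥0∞} (hf : Measurable f)
    (hf' : Measurable f') (h₁ : ∀ i, f (s i) = f' (s i))
    (h₂ : ∀ j, M.occ (fun i => (s i).2) j = 0 → ∀ θ, f (θ, some j) = f' (θ, some j))
    (h₃ : ∀ θ, f (θ, none) = f' (θ, none)) :
    ∫⁻ a, f a ∂M.urnMeasure s = ∫⁻ a, f' a ∂M.urnMeasure s := by
  rw [lintegral_urnMeasure M s hf, lintegral_urnMeasure M s hf']
  simp_rw [h₁, h₃]
  congr 2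
  refine Finset.sum_congr rfl fun j _ => ?_
  by_cases h : M.occ (fun i => (s i).2) j = 0
  · simp_rw [h₂ j h]
  · simp [freshWeight, h]

lemma ae_urnMeasure (s : ι → M.Atom) {p : M.Atom → Prop} (hp : MeasurableSet {a | p a})
    (h₁ : ∀ i, p (s i)) (h₂ : ∀ j, M.occ (fun i => (s i).2) j = 0 → ∀ θ, p (θ, some j))
    (h₃ : ∀ θ, p (θ, none)) : ∀ᵐ a ∂M.urnMeasure s, p a := by
  rw [ae_iff, ← Set.compl_ofPred, ← lintegral_indicator_one hp.compl,
    M.lintegral_urnMeasure_congr s (f' := 0) (measurable_one.indicator hp.compl) measurable_zero]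
  · simp
  · intro i; simp [h₁ i]
  · intro j hj θ; simp [h₂ j hj θ]
  · intro θ; simp [h₃ θ]

lemma occ_eq_sum (c : ι → Option (Fin M.D)) (j : Fin M.D) :
    M.occ c j = ∑ i, if c i = some j then 1 else 0 := by
  rw [occ, Finset.card_filter]

lemma occ_eq_zero_iff (c : ι → Option (Fin M.D)) (j : Fin M.D) :
    M.occ c j = 0 ↔ ∀ i, c i ≠ some j := by
  simp [occ_eq_sum]

lemma joinWeight_eq (c : ι → Option (Fin M.D)) (i : ι) :
    M.joinWeight c i = 1 + ∑ j, if c i = some j then (M.vstar j : ℝ≥0∞) / M.occ c j else 0 := by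
  cases h : c i with
  | none => simp [joinWeight, h]
  | some j =>
    have hpos : (M.occ c j : ℝ≥0∞) ≠ 0 := by
      rw [Nat.cast_ne_zero, Ne, occ_eq_zero_iff, not_forall]
      exact ⟨i, not_not.2 h⟩
    simp [joinWeight, h, ENNReal.add_div, ENNReal.div_self hpos (ENNReal.natCast_ne_top _)]

lemma joinWeight_le (c : ι → Option (Fin M.D)) (i : ι) :
    M.joinWeight c i ≤ Fintype.card ι + ∑ j, (M.vstar j : ℝ≥0∞) := by
  rw [← M.sum_joinWeight_add_sum_freshWeight c]
  exact (Finset.single_le_sum (f := fun i => M.joinWeight c i) (fun _ _ => zero_le)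
    (Finset.mem_univ i)).trans le_self_add

lemma freshWeight_le (c : ι → Option (Fin M.D)) (j : Fin M.D) :
    M.freshWeight c j ≤ M.vstar j := by
  unfold freshWeight; split_ifs <;> simp

section Reindex

variable {ι' : Type*} [Fintype ι'] (e : ι' ≃ ι)

lemma occ_comp_equiv (c : ι → Option (Fin M.D)) (j : Fin M.D) :
    M.occ (fun i => c (e i)) j = M.occ c j := by
  rw [occ_eq_sum, occ_eq_sum]
  exact Equiv.sum_comp e fun i => if c i = some j then 1 else 0

lemma urnMeasure_comp_equiv (s : ι → M.Atom) :
    M.urnMeasure (fun i => s (e i)) = M.urnMeasure s := by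
  have hj : ∀ i, M.joinWeight (fun i => (s (e i)).2) i = M.joinWeight (fun i => (s i).2) (e i) := by
    intro i
    rw [joinWeight_eq, joinWeight_eq]
    simp_rw [M.occ_comp_equiv e fun i => (s i).2]
  have hf : M.freshWeight (fun i => (s (e i)).2) = M.freshWeight fun i => (s i).2 := by
    ext j
    rw [freshWeight, freshWeight, M.occ_comp_equiv e fun i => (s i).2]
  unfold urnMeasure
  simp_rw [hj, hf]
  congr 2
  exact Equiv.sum_comp e fun i => M.joinWeight (fun i => (s i).2) i • Measure.dirac (s i)

end Reindex

/-- Law of the parameter and assignment of an object joining the transitioned cluster `j`: the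
parameter is drawn from `φ(θ*_j, ·)` if the cluster is unoccupied, and copied from one of its
members otherwise. -/
noncomputable def clusterMean (s : ι → M.Atom) (j : Fin M.D) (f : M.Atom → ℝ≥0∞) : ℝ≥0∞ :=
  if M.occ (fun i => (s i).2) j = 0 then ∫⁻ θ, f (θ, some j) ∂M.φ (M.θstar j)
  else (∑ i, if (s i).2 = some j then f (s i) else 0) / M.occ (fun i => (s i).2) j

/-- Each object contributes weight `1`, and each transitioned cluster an extra weight `v*` whether
occupied or not. In this form only `clusterMean` depends on the occupation. -/
lemma lintegral_urnMeasure_eq_clusterMean (s : ι → M.Atom) {f : M.Atom → ℝ≥0∞}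
    (hf : Measurable f) :
    ∫⁻ a, f a ∂M.urnMeasure s = ∑ i, f (s i) + ∑ j, M.vstar j * M.clusterMean s j f
      + M.α * ∫⁻ θ, f (θ, none) ∂M.H := by
  rw [lintegral_urnMeasure M s hf]
  congr 1
  simp_rw [joinWeight_eq, add_mul, one_mul, Finset.sum_add_distrib, Finset.sum_mul]
  rw [Finset.sum_comm, add_assoc, ← Finset.sum_add_distrib]
  congr 1
  refine Finset.sum_congr rfl fun j _ => ?_
  by_cases h : M.occ (fun i => (s i).2) j = 0
  · have h' := (M.occ_eq_zero_iff _ j).1 h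
    simp [clusterMean, freshWeight, h, h']
  · simp only [clusterMean, freshWeight, h, if_false, zero_mul, add_zero, ite_mul]
    simp_rw [div_eq_mul_inv, Finset.sum_mul, Finset.mul_sum, ite_mul, mul_ite, zero_mul, mul_zero]
    refine Finset.sum_congr rfl fun i _ => ?_
    split_ifs
    · ring
    · rfl

lemma clusterMean_eq_of_mem (s : ι → M.Atom) {j : Fin M.D} {a : M.Atom}
    (h : M.occ (fun i => (s i).2) j ≠ 0) (ha : ∀ i, (s i).2 = some j → s i = a)
    (f : M.Atom → ℝ≥0∞) : M.clusterMean s j f = f a := by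
  have h1 : ∑ i, (if (s i).2 = some j then f (s i) else 0)
      = M.occ (fun i => (s i).2) j * f a := by
    rw [occ_eq_sum, Nat.cast_sum, Finset.sum_mul]
    refine Finset.sum_congr rfl fun i _ => ?_
    split_ifs with hi
    · rw [ha i hi, Nat.cast_one, one_mul]
    · simp
  rw [clusterMean, if_neg h, h1, mul_comm,
    ENNReal.mul_div_cancel_right (by exact_mod_cast h) (ENNReal.natCast_ne_top _)]

end Urn

/-- The members of every transitioned cluster share their parameter. -/
def Coherent {ι : Type*} (s : ι → M.Atom) : Prop :=
  ∀ i i', (s i).2 = (s i').2 → (s i).2 ≠ none → s i = s i'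

/-- The atom `a` has the parameter of the transitioned cluster that it joins. -/
def CoherentWith {ι : Type*} (s : ι → M.Atom) (a : M.Atom) : Prop :=
  ∀ i, (s i).2 = a.2 → a.2 ≠ none → s i = a

variable {M}

lemma Coherent.snoc {n : ℕ} {s : M.State n} {a : M.Atom} (hs : M.Coherent s)
    (ha : M.CoherentWith s a) : M.Coherent (Fin.snoc s a : M.State (n + 1)) := by
  intro i i'
  refine Fin.lastCases ?_ (fun i => ?_) i <;> refine Fin.lastCases ?_ (fun i' => ?_) i'
  · simp
  · simp only [Fin.snoc_last, Fin.snoc_castSucc]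
    exact fun h h' => (ha i' h.symm h').symm
  · simp only [Fin.snoc_last, Fin.snoc_castSucc]
    exact fun h h' => ha i h (h ▸ h')
  · simp only [Fin.snoc_castSucc]
    exact hs i i'

lemma occ_snoc {n : ℕ} (s : M.State n) (a : M.Atom) (j : Fin M.D) :
    M.occ (fun i => ((Fin.snoc s a : M.State (n + 1)) i).2) j
      = M.occ (fun i => (s i).2) j + if a.2 = some j then 1 else 0 := by
  rw [occ_eq_sum, occ_eq_sum, Fin.sum_univ_castSucc]
  simp only [Fin.snoc_castSucc, Fin.snoc_last]

/-- After `a` joins cluster `j`, coherence makes every member equal to `a`, so the average is `f a`;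
the other clusters do not notice `a`. -/
lemma clusterMean_snoc {n : ℕ} {s : M.State n} {a : M.Atom} (ha : M.CoherentWith s a)
    (j : Fin M.D) (f : M.Atom → ℝ≥0∞) :
    M.clusterMean (Fin.snoc s a : M.State (n + 1)) j f
      = if a.2 = some j then f a else M.clusterMean s j f := by
  split_ifs with h
  · refine M.clusterMean_eq_of_mem _ (by rw [occ_snoc, if_pos h]; omega) (fun i => ?_) f
    refine Fin.lastCases ?_ (fun i => ?_) i
    · simp
    · simp only [Fin.snoc_castSucc]
      exact fun hi => ha i (hi.trans h.symm) (by simp [h])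
  · simp only [clusterMean, occ_snoc, h, if_false, add_zero, Fin.sum_univ_castSucc,
      Fin.snoc_castSucc, Fin.snoc_last]

/-- The urn measure after one more draw `a`. -/
lemma lintegral_urnMeasure_snoc {n : ℕ} {s : M.State n} {a : M.Atom} (ha : M.CoherentWith s a)
    {f : M.Atom → ℝ≥0∞} (hf : Measurable f) :
    ∫⁻ b, f b ∂M.urnMeasure (Fin.snoc s a : M.State (n + 1))
        + ∑ j, (if a.2 = some j then M.freshWeight (fun i => (s i).2) j else 0)
          * ∫⁻ θ, f (θ, some j) ∂M.φ (M.θstar j)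
      = ∫⁻ b, f b ∂M.urnMeasure s
        + (1 + ∑ j, if a.2 = some j then M.freshWeight (fun i => (s i).2) j else 0) * f a := by
  rw [lintegral_urnMeasure_eq_clusterMean M _ hf, lintegral_urnMeasure_eq_clusterMean M _ hf,
    Fin.sum_univ_castSucc]
  simp only [Fin.snoc_castSucc, Fin.snoc_last, clusterMean_snoc ha]
  -- If `a` is the first member of `j`, the weight `v*` moves from `φ(θ*_j, ·)` to `a`. If `j` was
  -- already occupied, its mean is `f a` before and after. Both correction sums avoid subtraction in
  -- `ℝ≥0∞`.
  have key : ∑ j, (M.vstar j : ℝ≥0∞) * (if a.2 = some j then f a else M.clusterMean s j f)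
      + ∑ j, (if a.2 = some j then M.freshWeight (fun i => (s i).2) j else 0)
          * ∫⁻ θ, f (θ, some j) ∂M.φ (M.θstar j)
      = ∑ j, (M.vstar j : ℝ≥0∞) * M.clusterMean s j f
        + (∑ j, if a.2 = some j then M.freshWeight (fun i => (s i).2) j else 0) * f a := by
    rw [Finset.sum_mul, ← Finset.sum_add_distrib, ← Finset.sum_add_distrib]
    refine Finset.sum_congr rfl fun j _ => ?_
    by_cases h : a.2 = some j
    · simp only [h, if_true]
      by_cases h0 : M.occ (fun i => (s i).2) j = 0
      · simp only [freshWeight, h0, clusterMean, if_true]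
        rw [add_comm]
      · rw [M.clusterMean_eq_of_mem s h0 fun i hi => ha i (hi.trans h.symm) (by simp [h])]
        simp [freshWeight, h0]
    · simp [h]
  have comm : ∀ S u A h B : ℝ≥0∞, S + u + A + h + B = S + u + h + (A + B) := fun _ _ _ _ _ => by ring
  rw [comm, key]
  ring

end DDPModel

/-! ### Exchangeability of the prior -/

namespace DDPModel

variable {Θ 𝓧 𝓩 : Type*} [MeasurableSpace Θ] (M : DDPModel Θ 𝓧 𝓩)

/-- The urn measure as a kernel. -/
noncomputable def urnKernel (n : ℕ) : Kernel (M.State n) M.Atom where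
  toFun := M.urnMeasure
  measurable' := M.measurable_urnMeasure

lemma urnKernel_apply {n : ℕ} (s : M.State n) : M.urnKernel n s = M.urnMeasure s := rfl

instance (n : ℕ) : IsFiniteKernel (M.urnKernel n) where
  exists_univ_le := ⟨M.g n, (M.g_ne_top n).lt_top, fun s => by
    rw [urnKernel_apply, urnMeasure_univ, Fintype.card_fin]⟩

instance {n : ℕ} (s : M.State n) : IsFiniteMeasure (M.urnMeasure s) :=
  inferInstanceAs (IsFiniteMeasure (M.urnKernel n s))

lemma measurable_lintegral_urnMeasure {n : ℕ} {f : M.State n × M.Atom → ℝ≥0∞}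
    (hf : Measurable f) : Measurable fun s => ∫⁻ a, f (s, a) ∂M.urnMeasure s :=
  hf.lintegral_kernel_prod_right' (κ := M.urnKernel n)

lemma lintegral_prior_succ (n : ℕ) {F : M.State (n + 1) → ℝ≥0∞} (hF : Measurable F) :
    ∫⁻ s, F s ∂M.prior (n + 1)
      = (M.g n)⁻¹ * ∫⁻ s, ∫⁻ a, F (Fin.snoc s a) ∂M.urnMeasure s ∂M.prior n := by
  have hF' : Measurable fun p : M.State n × M.Atom => F (Fin.snoc p.1 p.2) :=
    hF.comp (M.measurable_snoc n)
  rw [prior, lintegral_map hF (M.measurable_snoc n), Measure.lintegral_compProd hF',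
    ← lintegral_const_mul _ (M.measurable_lintegral_urnMeasure hF')]
  refine lintegral_congr fun s => ?_
  exact lintegral_smul_measure _ _

lemma ae_prior_succ (n : ℕ) {p : M.State (n + 1) → Prop} (hp : MeasurableSet {s | p s})
    (h : ∀ᵐ s ∂M.prior n, ∀ᵐ a ∂M.urnMeasure s, p (Fin.snoc s a)) :
    ∀ᵐ s ∂M.prior (n + 1), p s := by
  rw [ae_iff, ← Set.compl_ofPred, ← lintegral_indicator_one hp.compl,
    lintegral_prior_succ M n (measurable_one.indicator hp.compl),
    lintegral_congr_ae (g := fun _ => 0), lintegral_zero, mul_zero]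
  filter_upwards [h] with s hs
  rw [lintegral_congr_ae (g := fun _ => 0), lintegral_zero]
  filter_upwards [hs] with a ha
  simp [ha]

variable {M}

lemma coherentWith_urnMeasure {n : ℕ} {s : M.State n} (hs : M.Coherent s) :
    (∀ i, M.CoherentWith s (s i)) ∧
    (∀ j, M.occ (fun i => (s i).2) j = 0 → ∀ θ, M.CoherentWith s (θ, some j)) ∧
    ∀ θ, M.CoherentWith s (θ, none) :=
  ⟨fun i i' h h' => hs i' i h (h ▸ h'),
    fun j hj _ i h => absurd h ((M.occ_eq_zero_iff _ j).1 hj i), fun _ _ _ h => absurd rfl h⟩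

/-- The last two draws are exchangeable given the previous ones. -/
lemma lintegral_urnMeasure_swap {n : ℕ} {s : M.State n} (hs : M.Coherent s)
    {F : M.Atom × M.Atom → ℝ≥0∞} (hF : Measurable F) (hF1 : ∀ p, F p ≤ 1) :
    ∫⁻ a, ∫⁻ b, F (a, b) ∂M.urnMeasure (Fin.snoc s a : M.State (n + 1)) ∂M.urnMeasure s
      = ∫⁻ a, ∫⁻ b, F (b, a) ∂M.urnMeasure (Fin.snoc s a : M.State (n + 1)) ∂M.urnMeasure s := by
  set w : Fin M.D → ℝ≥0∞ := M.freshWeight fun i => (s i).2 with hw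
  have hlab : ∀ f : Option (Fin M.D) → ℝ≥0∞, Measurable fun a : M.Atom => f a.2 :=
    fun f => (measurable_of_countable f).comp measurable_snd
  -- The label of an existing object belongs to an occupied cluster, whose fresh weight is zero.
  have hw0 : ∀ i, ∀ j, (if (s i).2 = some j then w j else 0) = 0 := fun i j => by
    split_ifs with h
    · have : M.occ (fun i => (s i).2) j ≠ 0 := fun h0 => (M.occ_eq_zero_iff _ j).1 h0 i h
      simp [hw, freshWeight, this]
    · rfl
  -- Integrating the one-draw identity over `a` expresses the law of two draws through a product, a
  -- diagonal term and squares of `φ(θ*_j, ·)`. All three are symmetric in the two draws.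
  have main : ∀ F : M.Atom × M.Atom → ℝ≥0∞, Measurable F →
      ∫⁻ a, ∫⁻ b, F (a, b) ∂M.urnMeasure (Fin.snoc s a : M.State (n + 1)) ∂M.urnMeasure s
        + ∑ j, w j * (w j * ∫⁻ θ, ∫⁻ θ', F ((θ, some j), (θ', some j)) ∂M.φ (M.θstar j)
            ∂M.φ (M.θstar j))
      = ∫⁻ a, ∫⁻ b, F (a, b) ∂M.urnMeasure s ∂M.urnMeasure s
        + ∫⁻ a, (1 + ∑ j, if a.2 = some j then w j else 0) * F (a, a) ∂M.urnMeasure s := by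
    intro F hF
    have hsnoc : Measurable fun a : M.Atom => (Fin.snoc s a : M.State (n + 1)) :=
      (M.measurable_snoc n).comp measurable_prodMk_left
    have hI : Measurable fun a =>
        ∫⁻ b, F (a, b) ∂M.urnMeasure (Fin.snoc s a : M.State (n + 1)) :=
      hF.lintegral_kernel_prod_right' (κ := (M.urnKernel (n + 1)).comap _ hsnoc)
    have hJ : Measurable fun a => ∫⁻ b, F (a, b) ∂M.urnMeasure s := hF.lintegral_prod_right'
    have hφ : ∀ j, Measurable fun a : M.Atom => ∫⁻ θ, F (a, (θ, some j)) ∂M.φ (M.θstar j) :=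
      fun j => by
        have : Measurable fun p : M.Atom × Θ => F (p.1, (p.2, some j)) := by fun_prop
        exact this.lintegral_prod_right'
    have hX : Measurable fun a : M.Atom => ∑ j, (if a.2 = some j then w j else 0)
        * ∫⁻ θ, F (a, (θ, some j)) ∂M.φ (M.θstar j) :=
      Finset.measurable_sum _ fun j _ =>
        (hlab fun c => if c = some j then w j else 0).mul (hφ j)
    have hW : Measurable fun a : M.Atom =>
        (1 + ∑ j, if a.2 = some j then w j else 0) * F (a, a) :=
      (hlab fun c => 1 + ∑ j, if c = some j then w j else 0).mul
        (hF.comp (measurable_id.prodMk measurable_id))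
    have hXint : ∫⁻ a, ∑ j, (if a.2 = some j then w j else 0)
          * ∫⁻ θ, F (a, (θ, some j)) ∂M.φ (M.θstar j) ∂M.urnMeasure s
        = ∑ j, w j * (w j * ∫⁻ θ, ∫⁻ θ', F ((θ, some j), (θ', some j)) ∂M.φ (M.θstar j)
            ∂M.φ (M.θstar j)) := by
      rw [lintegral_urnMeasure M s hX]
      simp only [hw0, zero_mul, Finset.sum_const_zero, mul_zero, zero_add, reduceCtorEq, if_false,
        lintegral_zero, add_zero, Option.some_inj, ite_mul, Finset.sum_ite_eq, Finset.mem_univ,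
        if_true]
      refine Finset.sum_congr rfl fun j _ => ?_
      rw [lintegral_const_mul]
      exact (hφ j).comp measurable_prodMk_right
    rw [← hXint, ← lintegral_add_left hI, ← lintegral_add_left hJ]
    obtain ⟨h1, h2, h3⟩ := coherentWith_urnMeasure hs
    have heq : ∀ a, M.CoherentWith s a → _ := fun a ha => lintegral_urnMeasure_snoc ha
      (f := fun b => F (a, b)) (hF.comp measurable_prodMk_left)
    exact M.lintegral_urnMeasure_congr s (hI.add hX) (hJ.add hW) (fun i => heq _ (h1 i))
      (fun j hj θ => heq _ (h2 j hj θ)) fun θ => heq _ (h3 θ)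
  have h1 := main F hF
  have h2 := main (fun p => F (p.2, p.1)) (hF.comp measurable_swap)
  have hJs : ∫⁻ a, ∫⁻ b, F (a, b) ∂M.urnMeasure s ∂M.urnMeasure s
      = ∫⁻ a, ∫⁻ b, F (b, a) ∂M.urnMeasure s ∂M.urnMeasure s :=
    lintegral_lintegral_swap (f := fun a b => F (a, b)) hF.aemeasurable
  have hφs : ∀ j, ∫⁻ θ, ∫⁻ θ', F ((θ, some j), (θ', some j)) ∂M.φ (M.θstar j) ∂M.φ (M.θstar j)
      = ∫⁻ θ, ∫⁻ θ', F ((θ', some j), (θ, some j)) ∂M.φ (M.θstar j) ∂M.φ (M.θstar j) :=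
    fun j => by
      have : Measurable fun p : Θ × Θ => F ((p.1, some j), (p.2, some j)) := by fun_prop
      exact lintegral_lintegral_swap (f := fun θ θ' => F ((θ, some j), (θ', some j)))
        this.aemeasurable
  simp only [← hJs, ← hφs] at h2
  rw [← h2] at h1
  -- The symmetric term on the left can be cancelled because it is finite; this is where `F ≤ 1` is
  -- needed.
  refine (ENNReal.add_left_inj ?_).1 h1
  refine (ENNReal.sum_lt_top.2 fun j _ => ?_).ne
  have hwt : w j < ∞ := (M.freshWeight_le _ j).trans_lt (ENNReal.natCast_lt_top _)
  refine ENNReal.mul_lt_top hwt (ENNReal.mul_lt_top hwt ?_)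
  refine (lintegral_mono fun θ => lintegral_mono fun θ' => hF1 _).trans_lt ?_
  simp

variable (M)

/-- Coherence compares parameters, so it is an event because the diagonal of `Θ` is measurable. -/
lemma measurableSet_coherent [MeasurableEq Θ] (n : ℕ) :
    MeasurableSet {s : M.State n | M.Coherent s} := by
  simp only [Coherent, Prod.ext_iff]
  measurability

lemma ae_coherent_prior [MeasurableEq Θ] (n : ℕ) : ∀ᵐ s ∂M.prior n, M.Coherent s := by
  induction n with
  | zero => exact ae_of_all _ fun s i => i.elim0
  | succ n ih =>
    refine M.ae_prior_succ n (M.measurableSet_coherent _) ?_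
    filter_upwards [ih] with s hs
    obtain ⟨h1, h2, h3⟩ := coherentWith_urnMeasure hs
    have hm : Measurable fun a : M.Atom => (Fin.snoc s a : M.State (n + 1)) :=
      (M.measurable_snoc n).comp measurable_prodMk_left
    exact M.ae_urnMeasure s (hm (M.measurableSet_coherent _)) (fun i => hs.snoc (h1 i))
      (fun j hj θ => hs.snoc (h2 j hj θ)) fun θ => hs.snoc (h3 θ)

lemma measurable_comp_perm {n : ℕ} (σ : Equiv.Perm (Fin n)) :
    Measurable fun (s : M.State n) i => s (σ i) := by fun_prop

/-- Indicators suffice as test functions; the bound by `1` supplies the finiteness used when the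
last two draws are swapped. -/
lemma measurePreserving_of_lintegral {n : ℕ} {σ : Equiv.Perm (Fin n)}
    (h : ∀ F : M.State n → ℝ≥0∞, Measurable F → (∀ s, F s ≤ 1) →
      ∫⁻ s, F (fun i => s (σ i)) ∂M.prior n = ∫⁻ s, F s ∂M.prior n) :
    MeasurePreserving (fun (s : M.State n) i => s (σ i)) (M.prior n) (M.prior n) := by
  refine ⟨M.measurable_comp_perm σ, Measure.ext fun A hA => ?_⟩
  have h1 := h (A.indicator 1) (measurable_one.indicator hA)
    fun s => Set.indicator_le_self' (fun _ _ => zero_le) s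
  rw [lintegral_indicator_one hA] at h1
  rw [← h1, ← lintegral_indicator_one hA,
    lintegral_map (measurable_one.indicator hA) (M.measurable_comp_perm σ)]

lemma measurePreserving_perm_snoc {n : ℕ} {σ : Equiv.Perm (Fin n)}
    (hσ : MeasurePreserving (fun (s : M.State n) i => s (σ i)) (M.prior n) (M.prior n))
    {τ : Equiv.Perm (Fin (n + 1))} (hτ : ∀ i : Fin n, τ i.castSucc = (σ i).castSucc)
    (hlast : τ (Fin.last n) = Fin.last n) :
    MeasurePreserving (fun (s : M.State (n + 1)) i => s (τ i)) (M.prior (n + 1))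
      (M.prior (n + 1)) := by
  refine M.measurePreserving_of_lintegral fun F hF _ => ?_
  have hsnoc : ∀ (s : M.State n) (a : M.Atom), (fun i => (Fin.snoc s a : M.State (n + 1)) (τ i))
      = (Fin.snoc (fun i => s (σ i)) a : M.State (n + 1)) := fun s a => by
    funext i
    refine Fin.lastCases ?_ (fun i => ?_) i
    · simp [hlast]
    · simp [hτ]
  have hFτ : Measurable fun s : M.State (n + 1) => F fun i => s (τ i) :=
    hF.comp (M.measurable_comp_perm τ)
  have hFs : Measurable fun p : M.State n × M.Atom => F (Fin.snoc p.1 p.2) :=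
    hF.comp (M.measurable_snoc n)
  rw [lintegral_prior_succ M n hFτ, lintegral_prior_succ M n hF]
  simp_rw [hsnoc]
  congr 1
  rw [← hσ.lintegral_comp (M.measurable_lintegral_urnMeasure hFs)]
  refine lintegral_congr fun s => ?_
  rw [M.urnMeasure_comp_equiv σ s]

lemma measurePreserving_swap_last [MeasurableEq Θ] (n : ℕ) :
    MeasurePreserving
      (fun (s : M.State (n + 2)) i => s (Equiv.swap (Fin.last n).castSucc (Fin.last (n + 1)) i))
      (M.prior (n + 2)) (M.prior (n + 2)) := by
  refine M.measurePreserving_of_lintegral fun F hF hF1 => ?_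
  have two : ∀ F : M.State (n + 2) → ℝ≥0∞, Measurable F →
      ∫⁻ s, F s ∂M.prior (n + 2) = (M.g (n + 1))⁻¹ * ((M.g n)⁻¹ * ∫⁻ s, ∫⁻ a, ∫⁻ b,
        F (Fin.snoc (Fin.snoc s a : M.State (n + 1)) b) ∂M.urnMeasure
          (Fin.snoc s a : M.State (n + 1)) ∂M.urnMeasure s ∂M.prior n) := fun F hF => by
    have hFs : Measurable fun p : M.State (n + 1) × M.Atom => F (Fin.snoc p.1 p.2) :=
      hF.comp (M.measurable_snoc (n + 1))
    rw [lintegral_prior_succ M (n + 1) hF, lintegral_prior_succ M n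
      (M.measurable_lintegral_urnMeasure hFs)]
  have hsnoc : ∀ (s : M.State n) (a b : M.Atom),
      (fun i => (Fin.snoc (Fin.snoc s a : M.State (n + 1)) b : M.State (n + 2))
        (Equiv.swap (Fin.last n).castSucc (Fin.last (n + 1)) i))
      = (Fin.snoc (Fin.snoc s b : M.State (n + 1)) a : M.State (n + 2)) := fun s a b => by
    funext i
    refine Fin.lastCases ?_ (fun i => ?_) i
    · simp
    · refine Fin.lastCases ?_ (fun i => ?_) i
      · simp
      · rw [Equiv.swap_apply_of_ne_of_ne]
        · simp
        · simp [Fin.ext_iff, i.2.ne]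
        · simp [Fin.ext_iff]; omega
  have hFσ : Measurable fun s : M.State (n + 2) =>
      F fun i => s (Equiv.swap (Fin.last n).castSucc (Fin.last (n + 1)) i) :=
    hF.comp (M.measurable_comp_perm _)
  rw [two F hF, two _ hFσ]
  simp_rw [hsnoc]
  congr 2
  refine lintegral_congr_ae ?_
  filter_upwards [M.ae_coherent_prior n] with s hs
  have hm : Measurable fun p : M.Atom × M.Atom =>
      (Fin.snoc (Fin.snoc s p.2 : M.State (n + 1)) p.1 : M.State (n + 2)) :=
    (M.measurable_snoc (n + 1)).comp
      (((M.measurable_snoc n).comp (measurable_const.prodMk measurable_snd)).prodMk measurable_fst)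
  exact lintegral_urnMeasure_swap hs (hF.comp hm) fun p => hF1 _

/-- The prior is exchangeable. -/
theorem measurePreserving_perm [MeasurableEq Θ] {n : ℕ} (σ : Equiv.Perm (Fin n)) :
    MeasurePreserving (fun (s : M.State n) i => s (σ i)) (M.prior n) (M.prior n) := by
  induction n with
  | zero => rw [Subsingleton.elim σ 1]; exact MeasurePreserving.id _
  | succ n ih =>
    -- Adjacent transpositions generate. The last one is the two-draw symmetry, and the others fix
    -- the last object and fall under the induction hypothesis.
    have hσ : σ ∈ Submonoid.closure (Set.range fun i : Fin n => Equiv.swap i.castSucc i.succ) := by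
      rw [Equiv.Perm.mclosure_swap_castSucc_succ]; trivial
    induction hσ using Submonoid.closure_induction with
    | one => exact MeasurePreserving.id _
    | mul σ τ _ _ hσ hτ => exact hτ.comp hσ
    | mem τ hτ =>
      obtain ⟨i, rfl⟩ := hτ
      cases n with
      | zero => exact i.elim0
      | succ n =>
        refine Fin.lastCases ?_ (fun i => ?_) i
        · exact M.measurePreserving_swap_last n
        · refine M.measurePreserving_perm_snoc (ih (Equiv.swap i.castSucc i.succ)) ?_ ?_
          · intro k
            simp only [Equiv.swap_apply_def, Fin.succ_castSucc]
            simp only [Fin.castSucc_inj]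
            split_ifs <;> rfl
          · rw [Equiv.swap_apply_of_ne_of_ne]
            · simp [Fin.ext_iff]; omega
            · simp [Fin.ext_iff]; omega

/-- The prior conditional of an object given all the others is the urn measure. -/
theorem lintegral_prior_insertNth [MeasurableEq Θ] {n : ℕ} (ℓ : Fin (n + 1))
    {F : M.State (n + 1) → ℝ≥0∞} (hF : Measurable F) :
    ∫⁻ s, F s ∂M.prior (n + 1)
      = (M.g n)⁻¹ * ∫⁻ r, ∫⁻ a, F (ℓ.insertNth a r) ∂M.urnMeasure r ∂M.prior n := by
  -- This permutation sends `ℓ` to the last place and keeps the order of the others.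
  set σ : Equiv.Perm (Fin (n + 1)) := (finSuccEquiv' ℓ).trans (finSuccEquiv' (Fin.last n)).symm
  have hFσ : Measurable fun s : M.State (n + 1) => F fun i => s (σ i) :=
    hF.comp (M.measurable_comp_perm σ)
  rw [← (M.measurePreserving_perm σ).lintegral_comp hF, lintegral_prior_succ M n hFσ]
  congr 1
  refine lintegral_congr fun r => lintegral_congr fun a => congrArg F ?_
  rw [Fin.eq_insertNth_iff]
  constructor
  · simp [σ]
  · funext i
    simp [σ, Fin.removeNth]

end DDPModel

/-! ### Positivity of the evidence and normalisers of the full conditionals -/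

namespace DDPModel

variable {Θ 𝓧 𝓩 : Type*} [MeasurableSpace Θ] (M : DDPModel Θ 𝓧 𝓩)

/-- With positive prior probability all objects are in clusters created at time `k` and have
parameters at which given functions, not `H`-almost everywhere zero, do not vanish. -/
lemma prior_setOf_forall_none_ne_zero {n : ℕ} (f : Fin n → Θ → ℝ≥0∞) (hf : ∀ i, Measurable (f i))
    (h : ∀ i, ∫⁻ θ, f i θ ∂M.H ≠ 0) :
    M.prior n {s | ∀ i, (s i).2 = none ∧ f i (s i).1 ≠ 0} ≠ 0 := by
  have hmeas : ∀ {n : ℕ} (f : Fin n → Θ → ℝ≥0∞), (∀ i, Measurable (f i)) →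
      MeasurableSet {s : M.State n | ∀ i, (s i).2 = none ∧ f i (s i).1 ≠ 0} := fun f hf => by
    rw [Set.ofPred_forall]
    refine MeasurableSet.iInter fun i => MeasurableSet.inter ?_ ?_
    · exact (measurable_snd.comp (measurable_pi_apply i)) (MeasurableSet.singleton none)
    · exact ((hf i).comp (measurable_fst.comp (measurable_pi_apply i)))
        (MeasurableSet.singleton 0).compl
  induction n with
  | zero => simp [prior]
  | succ n ih =>
    set W := {s : M.State n | ∀ i, (s i).2 = none ∧ f i.castSucc (s i).1 ≠ 0}
    have hW : M.prior n W ≠ 0 := ih (fun i => f i.castSucc) (fun i => hf _) fun i => h _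
    set S := {θ | f (Fin.last n) θ ≠ 0}
    have hS : M.H S ≠ 0 := fun h0 => h (Fin.last n) <| by
      rw [lintegral_eq_zero_iff (hf _)]
      exact h0
    have hα : (M.α : ℝ≥0∞) ≠ 0 := by exact_mod_cast M.α_pos.ne'
    have hWm : MeasurableSet W := hmeas _ fun i => hf _
    have hSm : MeasurableSet S := (hf (Fin.last n)) (MeasurableSet.singleton 0).compl
    have hind := (measurable_one (α := ℝ≥0∞)).indicator (hmeas f hf)
    -- A lower bound for the probability: the first `n` objects lie in `W`, and the last one opens a
    -- new cluster with parameter in `S`.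
    have hpos : (M.g n)⁻¹ * (M.α * M.H S * M.prior n W) ≠ 0 :=
      mul_ne_zero (ENNReal.inv_ne_zero.2 (M.g_ne_top n)) (mul_ne_zero (mul_ne_zero hα hS) hW)
    refine fun h0 => hpos (le_antisymm (le_trans ?_ h0.le) zero_le)
    rw [← lintegral_indicator_one (hmeas f hf), lintegral_prior_succ M n hind,
      ← setLIntegral_const, ← lintegral_indicator hWm]
    gcongr with s
    by_cases hs : s ∈ W
    · have hsnoc : Measurable fun a : M.Atom => (Fin.snoc s a : M.State (n + 1)) :=
        (M.measurable_snoc n).comp measurable_prodMk_left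
      rw [Set.indicator_of_mem hs]
      refine le_trans ?_ (lintegral_urnMeasure M s (hind.comp hsnoc)).ge
      refine le_trans ?_ le_add_self
      rw [← lintegral_indicator_one hSm]
      gcongr with θ
      by_cases hθ : θ ∈ S
      · rw [Set.indicator_of_mem hθ, Function.comp_apply, Set.indicator_of_mem]
        · simp
        · intro i
          refine Fin.lastCases ?_ (fun i => ?_) i
          · simpa only [Fin.snoc_last] using ⟨trivial, hθ⟩
          · simpa using hs i
      · simp [hθ]
    · simp [hs]

section Gibbs

variable {N : ℕ} (x : Fin N → 𝓧) (z : Fin N → 𝓩)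

lemma measurable_jointLik : Measurable (M.jointLik x z) :=
  Finset.measurable_prod _ fun ℓ _ =>
    (M.measurable_lik x z ℓ).comp (measurable_fst.comp (measurable_pi_apply ℓ))

variable {x z} in
lemma evidence_ne_zero (hH : ∀ ℓ, ∫⁻ θ, M.lik x z ℓ θ ∂M.H ≠ 0) : M.evidence x z ≠ 0 := by
  rw [evidence, Ne, lintegral_eq_zero_iff (M.measurable_jointLik x z)]
  refine fun h => M.prior_setOf_forall_none_ne_zero _ (M.measurable_lik x z) hH
    (measure_mono_null ?_ h)
  intro s hs
  simp only [Set.mem_compl_iff, Set.mem_ofPred_eq]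
  exact Finset.prod_ne_zero_iff.2 fun i _ => (hs i).2

variable {x z} in
lemma isProbabilityMeasure_posterior (hH : ∀ ℓ, ∫⁻ θ, M.lik x z ℓ θ ∂M.H ≠ 0)
    (hev : M.evidence x z ≠ ∞) : IsProbabilityMeasure (M.posterior x z) := by
  refine ⟨?_⟩
  rw [posterior, Measure.smul_apply, withDensity_apply _ MeasurableSet.univ, Measure.restrict_univ]
  exact ENNReal.inv_mul_cancel (M.evidence_ne_zero hH) hev

lemma lintegral_posterior {F : M.State N → ℝ≥0∞} (hF : Measurable F) :
    ∫⁻ s, F s ∂M.posterior x z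
      = (M.evidence x z)⁻¹ * ∫⁻ s, M.jointLik x z s * F s ∂M.prior N := by
  rw [posterior, lintegral_smul_measure,
    lintegral_withDensity_eq_lintegral_mul _ (M.measurable_jointLik x z) hF]
  rfl

lemma measurable_lik_fst (ℓ : Fin N) : Measurable fun a : M.Atom => M.lik x z ℓ a.1 :=
  (M.measurable_lik x z ℓ).comp measurable_fst

lemma gibbsMeasure_univ (ℓ : Fin N) (s : M.State N) :
    M.gibbsMeasure x z ℓ s Set.univ
      = ∑ i : {i // i ≠ ℓ}, M.joinWeight (fun i : {i // i ≠ ℓ} => (s i).2) i * M.lik x z ℓ (s i).1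
      + ∑ j, M.freshWeight (fun i : {i // i ≠ ℓ} => (s i).2) j
          * ∫⁻ θ, M.lik x z ℓ θ ∂M.φ (M.θstar j)
      + M.α * ∫⁻ θ, M.lik x z ℓ θ ∂M.H := by
  rw [gibbsMeasure, withDensity_apply _ MeasurableSet.univ, Measure.restrict_univ,
    M.lintegral_urnMeasure _ (M.measurable_lik_fst x z ℓ)]

/-- Bound for the normaliser of a full conditional in terms of a bound for the likelihoods. -/
noncomputable def normaliserBound (ℓ : Fin N) (m : ℝ≥0∞) : ℝ≥0∞ :=
  N * ((N + ∑ j, (M.vstar j : ℝ≥0∞)) * m)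
    + ∑ j, M.vstar j * ∫⁻ θ, M.lik x z ℓ θ ∂M.φ (M.θstar j)
    + M.α * ∫⁻ θ, M.lik x z ℓ θ ∂M.H

lemma gibbsMeasure_univ_le (ℓ : Fin N) (s : M.State N) {m : ℝ≥0∞}
    (hm : ∀ i, M.lik x z ℓ (s i).1 ≤ m) :
    M.gibbsMeasure x z ℓ s Set.univ ≤ M.normaliserBound x z ℓ m := by
  have hcard : (Fintype.card {i : Fin N // i ≠ ℓ} : ℝ≥0∞) ≤ N := by
    exact_mod_cast (Fintype.card_subtype_le _).trans (Fintype.card_fin N).le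
  rw [gibbsMeasure_univ, normaliserBound]
  refine add_le_add (add_le_add ?_ (Finset.sum_le_sum fun j _ => ?_)) le_rfl
  · calc _ ≤ ∑ _i : {i : Fin N // i ≠ ℓ}, (N + ∑ j, (M.vstar j : ℝ≥0∞)) * m :=
          Finset.sum_le_sum fun i _ => mul_le_mul'
            ((M.joinWeight_le _ i).trans (add_le_add hcard le_rfl)) (hm i)
      _ = Fintype.card {i : Fin N // i ≠ ℓ} * ((N + ∑ j, (M.vstar j : ℝ≥0∞)) * m) := by
          rw [Finset.sum_const, nsmul_eq_mul, Finset.card_univ]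
      _ ≤ _ := mul_le_mul' hcard le_rfl
  · exact mul_le_mul' (M.freshWeight_le _ j) le_rfl

variable {x z} in
lemma gibbsMeasure_univ_ne_zero {ℓ : Fin N} (hH : ∫⁻ θ, M.lik x z ℓ θ ∂M.H ≠ 0)
    (s : M.State N) : M.gibbsMeasure x z ℓ s Set.univ ≠ 0 := by
  have hα : (M.α : ℝ≥0∞) ≠ 0 := by exact_mod_cast M.α_pos.ne'
  rw [gibbsMeasure_univ]
  exact fun h => mul_ne_zero hα hH (add_eq_zero.1 h).2

lemma lintegral_gibbsMeasure (ℓ : Fin N) (s : M.State N) {f : M.Atom → ℝ≥0∞}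
    (hf : Measurable f) : ∫⁻ a, f a ∂M.gibbsMeasure x z ℓ s
      = ∫⁻ a, M.lik x z ℓ a.1 * f a ∂M.urnMeasure fun i : {i : Fin N // i ≠ ℓ} => s i :=
  lintegral_withDensity_eq_lintegral_mul _ (M.measurable_lik_fst x z ℓ) hf

lemma measurable_update_const (ℓ : Fin N) (s : M.State N) :
    Measurable fun a : M.Atom => (Function.update s ℓ a : M.State N) :=
  measurable_update s

lemma lintegral_gibbsUpdate (ℓ : Fin N) (s : M.State N) {F : M.State N → ℝ≥0∞}
    (hF : Measurable F) : ∫⁻ t, F t ∂M.gibbsUpdate x z ℓ s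
      = (M.gibbsMeasure x z ℓ s Set.univ)⁻¹
        * ∫⁻ a, F (Function.update s ℓ a) ∂M.gibbsMeasure x z ℓ s := by
  rw [gibbsUpdate_apply, lintegral_map hF (M.measurable_update_const ℓ s)]
  exact lintegral_smul_measure _ _

/-- The kernel that updates the objects of a list in turn. -/
noncomputable def gibbsUpdates (l : List (Fin N)) : Kernel (M.State N) (M.State N) :=
  l.foldl (fun κ ℓ => M.gibbsUpdate x z ℓ ∘ₖ κ) Kernel.id

lemma gibbsUpdates_nil : M.gibbsUpdates x z [] = Kernel.id := rfl

lemma gibbsUpdates_append (l : List (Fin N)) (ℓ : Fin N) :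
    M.gibbsUpdates x z (l ++ [ℓ]) = M.gibbsUpdate x z ℓ ∘ₖ M.gibbsUpdates x z l := by
  simp [gibbsUpdates]

lemma gibbsSweep_eq : M.gibbsSweep x z = M.gibbsUpdates x z (List.finRange N) := rfl

end Gibbs

section InsertNth

variable {n : ℕ} (x : Fin (n + 1) → 𝓧) (z : Fin (n + 1) → 𝓩) (ℓ : Fin (n + 1))

lemma jointLik_insertNth (a : M.Atom) (r : M.State n) :
    M.jointLik x z (ℓ.insertNth a r)
      = M.lik x z ℓ a.1 * ∏ i, M.lik x z (ℓ.succAbove i) (r i).1 := by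
  rw [jointLik, Fin.prod_univ_succAbove _ ℓ]
  simp

lemma urnMeasure_insertNth (a : M.Atom) (r : M.State n) :
    (M.urnMeasure fun i : {i : Fin (n + 1) // i ≠ ℓ} => (ℓ.insertNth a r : M.State (n + 1)) i)
      = M.urnMeasure r := by
  rw [← M.urnMeasure_comp_equiv (finSuccAboveEquiv ℓ)]
  congr 1
  funext i
  exact Fin.insertNth_apply_succAbove (α := fun _ => M.Atom) ℓ a r i

lemma gibbsMeasure_insertNth (a : M.Atom) (r : M.State n) :
    M.gibbsMeasure x z ℓ (ℓ.insertNth a r)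
      = (M.urnMeasure r).withDensity fun a => M.lik x z ℓ a.1 := by
  rw [gibbsMeasure, urnMeasure_insertNth]

lemma gibbsMeasure_insertNth_univ (a : M.Atom) (r : M.State n) :
    M.gibbsMeasure x z ℓ (ℓ.insertNth a r) Set.univ
      = ∫⁻ a, M.lik x z ℓ a.1 ∂M.urnMeasure r := by
  rw [gibbsMeasure_insertNth, withDensity_apply _ MeasurableSet.univ, Measure.restrict_univ]

lemma lintegral_gibbsUpdate_insertNth (b : M.Atom) (r : M.State n)
    {F : M.State (n + 1) → ℝ≥0∞} (hF : Measurable F) :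
    ∫⁻ t, F t ∂M.gibbsUpdate x z ℓ (ℓ.insertNth b r)
      = (∫⁻ a, M.lik x z ℓ a.1 ∂M.urnMeasure r)⁻¹
        * ∫⁻ a, M.lik x z ℓ a.1 * F (ℓ.insertNth a r) ∂M.urnMeasure r := by
  have hF' : Measurable fun a : M.Atom => F (Function.update (ℓ.insertNth b r) ℓ a) :=
    hF.comp (M.measurable_update_const ℓ (ℓ.insertNth b r))
  rw [lintegral_gibbsUpdate M x z ℓ _ hF, gibbsMeasure_insertNth_univ,
    lintegral_gibbsMeasure M x z ℓ _ hF', urnMeasure_insertNth]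
  simp only [Fin.update_insertNth]

variable {x z}

/-- The evidence is, up to a constant, the integral of normaliser times likelihood of the other
objects. Its finiteness gives a configuration with finite normaliser and all others in new clusters;
there every transitioned cluster is free and each integral appears as a summand. -/
lemma integrals_lik_ne_top [MeasurableEq Θ] (hH : ∀ ℓ, ∫⁻ θ, M.lik x z ℓ θ ∂M.H ≠ 0)
    (hev : M.evidence x z ≠ ∞) :
    M.α * ∫⁻ θ, M.lik x z ℓ θ ∂M.H ≠ ∞ ∧
      ∀ j, M.vstar j * ∫⁻ θ, M.lik x z ℓ θ ∂M.φ (M.θstar j) ≠ ∞ := by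
  set Z : M.State n → ℝ≥0∞ := fun r => ∫⁻ a, M.lik x z ℓ a.1 ∂M.urnMeasure r
  set L : M.State n → ℝ≥0∞ := fun r => ∏ i, M.lik x z (ℓ.succAbove i) (r i).1
  have hZ : Measurable Z :=
    M.measurable_lintegral_urnMeasure ((M.measurable_lik_fst x z ℓ).comp measurable_snd)
  have hL : Measurable L := Finset.measurable_prod _ fun i _ =>
    (M.measurable_lik x z _).comp (measurable_fst.comp (measurable_pi_apply i))
  have hint : ∫⁻ r, Z r * L r ∂M.prior n ≠ ∞ := by
    intro h
    refine hev ?_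
    rw [evidence, M.lintegral_prior_insertNth ℓ (M.measurable_jointLik x z)]
    simp_rw [jointLik_insertNth, lintegral_mul_const _ (M.measurable_lik_fst x z ℓ)]
    refine Eq.trans (congrArg _ h) (ENNReal.mul_top (ENNReal.inv_ne_zero.2 (M.g_ne_top n)))
  have hpos := M.prior_setOf_forall_none_ne_zero (fun i => M.lik x z (ℓ.succAbove i))
    (fun i => M.measurable_lik x z _) fun i => hH _
  obtain ⟨r, hr, hfin⟩ := ((frequently_ae_mem_iff.2 hpos).and_eventually
    (ae_lt_top (hZ.mul hL) hint)).exists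
  have hLr : L r ≠ 0 := Finset.prod_ne_zero_iff.2 fun i _ => (hr i).2
  have hZr : Z r ≠ ∞ := fun h => by
    rw [Pi.mul_apply, h, ENNReal.top_mul hLr] at hfin
    exact lt_irrefl _ hfin
  change ∫⁻ a, M.lik x z ℓ a.1 ∂M.urnMeasure r ≠ ∞ at hZr
  rw [M.lintegral_urnMeasure r (M.measurable_lik_fst x z ℓ)] at hZr
  obtain ⟨h1, h2⟩ := ENNReal.add_ne_top.1 hZr
  refine ⟨h2, fun j => ?_⟩
  have h3 := ENNReal.sum_ne_top.1 (ENNReal.add_ne_top.1 h1).2 j (Finset.mem_univ j)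
  have hocc : M.occ (fun i => (r i).2) j = 0 := (M.occ_eq_zero_iff _ j).2 fun i => by
    simp [(hr i).1]
  simpa [freshWeight, hocc] using h3

end InsertNth

/-! ### Markov property, invariance and absolute continuity of the sampler -/

section Sampler

variable {N : ℕ} {x : Fin N → 𝓧} {z : Fin N → 𝓩}

lemma normaliserBound_ne_top [MeasurableEq Θ] (hH : ∀ ℓ, ∫⁻ θ, M.lik x z ℓ θ ∂M.H ≠ 0)
    (hev : M.evidence x z ≠ ∞) (ℓ : Fin N) {m : ℝ≥0∞} (hm : m ≠ ∞) :
    M.normaliserBound x z ℓ m ≠ ∞ := by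
  cases N with
  | zero => exact ℓ.elim0
  | succ n =>
    obtain ⟨h1, h2⟩ := M.integrals_lik_ne_top ℓ hH hev
    refine ENNReal.add_ne_top.2 ⟨ENNReal.add_ne_top.2 ⟨?_, ENNReal.sum_ne_top.2 fun j _ => h2 j⟩, h1⟩
    refine ENNReal.mul_ne_top (ENNReal.natCast_ne_top _) (ENNReal.mul_ne_top ?_ hm)
    exact ENNReal.add_ne_top.2 ⟨ENNReal.natCast_ne_top _,
      ENNReal.sum_ne_top.2 fun j _ => ENNReal.natCast_ne_top _⟩

lemma gibbsMeasure_univ_ne_top [MeasurableEq Θ] (hH : ∀ ℓ, ∫⁻ θ, M.lik x z ℓ θ ∂M.H ≠ 0)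
    (hev : M.evidence x z ≠ ∞) (ℓ : Fin N) (s : M.State N) :
    M.gibbsMeasure x z ℓ s Set.univ ≠ ∞ := by
  refine ne_top_of_le_ne_top (M.normaliserBound_ne_top hH hev ℓ ?_)
    -- At a single state the finitely many likelihood values are finite, so their sum is a valid
    -- bound. Hence the normaliser is finite at every state, not just almost everywhere.
    (M.gibbsMeasure_univ_le x z ℓ s (m := ∑ i, M.lik x z ℓ (s i).1) fun i =>
      Finset.single_le_sum (f := fun i => M.lik x z ℓ (s i).1) (fun _ _ => zero_le)
        (Finset.mem_univ i))
  exact ENNReal.sum_ne_top.2 fun i _ => ENNReal.coe_ne_top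

lemma isMarkovKernel_gibbsUpdate [MeasurableEq Θ] (hH : ∀ ℓ, ∫⁻ θ, M.lik x z ℓ θ ∂M.H ≠ 0)
    (hev : M.evidence x z ≠ ∞) (ℓ : Fin N) : IsMarkovKernel (M.gibbsUpdate x z ℓ) := by
  refine ⟨fun s => ⟨?_⟩⟩
  rw [← lintegral_one, M.lintegral_gibbsUpdate x z ℓ s measurable_const, lintegral_one]
  exact ENNReal.inv_mul_cancel (M.gibbsMeasure_univ_ne_zero (hH ℓ) s)
    (M.gibbsMeasure_univ_ne_top hH hev ℓ s)

lemma isMarkovKernel_gibbsUpdates [MeasurableEq Θ] (hH : ∀ ℓ, ∫⁻ θ, M.lik x z ℓ θ ∂M.H ≠ 0)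
    (hev : M.evidence x z ≠ ∞) (l : List (Fin N)) : IsMarkovKernel (M.gibbsUpdates x z l) := by
  induction l using List.reverseRecOn with
  | nil => exact inferInstanceAs (IsMarkovKernel Kernel.id)
  | append_singleton l ℓ ih =>
    have := M.isMarkovKernel_gibbsUpdate hH hev ℓ
    rw [gibbsUpdates_append]
    infer_instance

/-- The posterior is invariant under the update of an object from its full conditional. -/
lemma invariant_gibbsUpdate [MeasurableEq Θ] (hH : ∀ ℓ, ∫⁻ θ, M.lik x z ℓ θ ∂M.H ≠ 0)
    (hev : M.evidence x z ≠ ∞) (ℓ : Fin N) :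
    (M.gibbsUpdate x z ℓ).Invariant (M.posterior x z) := by
  cases N with
  | zero => exact ℓ.elim0
  | succ n =>
    refine Measure.ext_of_lintegral _ fun F hF => ?_
    have hJ := M.measurable_jointLik x z
    have hKF : Measurable fun s => ∫⁻ t, F t ∂M.gibbsUpdate x z ℓ s := hF.lintegral_kernel
    have hJK : Measurable fun s => M.jointLik x z s * ∫⁻ t, F t ∂M.gibbsUpdate x z ℓ s :=
      hJ.mul hKF
    have hJF : Measurable fun s => M.jointLik x z s * F s := hJ.mul hF
    rw [Measure.lintegral_bind (M.gibbsUpdate x z ℓ).aemeasurable hF.aemeasurable,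
      lintegral_posterior M x z hKF, lintegral_posterior M x z hF,
      M.lintegral_prior_insertNth ℓ hJK, M.lintegral_prior_insertNth ℓ hJF]
    congr 2
    refine lintegral_congr fun r => ?_
    simp only [M.lintegral_gibbsUpdate_insertNth x z ℓ _ r hF, jointLik_insertNth]
    set L := ∏ i, M.lik x z (ℓ.succAbove i) (r i).1
    obtain ⟨a₀⟩ : Nonempty M.Atom := ⟨(M.H.nonempty_of_neZero.some, none)⟩
    have hZ0 : ∫⁻ a, M.lik x z ℓ a.1 ∂M.urnMeasure r ≠ 0 := by
      rw [← M.gibbsMeasure_insertNth_univ x z ℓ a₀ r]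
      exact M.gibbsMeasure_univ_ne_zero (hH ℓ) _
    have hZt : ∫⁻ a, M.lik x z ℓ a.1 ∂M.urnMeasure r ≠ ∞ := by
      rw [← M.gibbsMeasure_insertNth_univ x z ℓ a₀ r]
      exact M.gibbsMeasure_univ_ne_top hH hev ℓ _
    have hlik := M.measurable_lik_fst x z ℓ
    have hins : Measurable fun a : M.Atom => (ℓ.insertNth a r : M.State (n + 1)) :=
      (MeasurableEquiv.piFinSuccAbove (fun _ => M.Atom) ℓ).symm.measurable.comp
        measurable_prodMk_right
    have hlF : Measurable fun a : M.Atom => M.lik x z ℓ a.1 * F (ℓ.insertNth a r) :=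
      hlik.mul (hF.comp hins)
    simp_rw [mul_assoc, lintegral_mul_const _ hlik]
    simp_rw [mul_left_comm _ L, lintegral_const_mul _ hlF]
    rw [← mul_assoc _ _⁻¹, ENNReal.mul_inv_cancel hZ0 hZt, one_mul]

lemma invariant_gibbsUpdates [MeasurableEq Θ] (hH : ∀ ℓ, ∫⁻ θ, M.lik x z ℓ θ ∂M.H ≠ 0)
    (hev : M.evidence x z ≠ ∞) (l : List (Fin N)) :
    (M.gibbsUpdates x z l).Invariant (M.posterior x z) := by
  induction l using List.reverseRecOn with
  | nil => exact Measure.id_comp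
  | append_singleton l ℓ ih =>
    rw [gibbsUpdates_append]
    exact (M.invariant_gibbsUpdate hH hev ℓ).comp ih

/-- The full conditional has a density with respect to the urn measure, which is the prior
conditional up to normalisation. A prior null set is therefore null for almost every configuration
of the other objects. -/
lemma gibbsUpdate_comp_prior_absolutelyContinuous [MeasurableEq Θ] (ℓ : Fin N) :
    M.gibbsUpdate x z ℓ ∘ₘ M.prior N ≪ M.prior N := by
  cases N with
  | zero => exact ℓ.elim0
  | succ n =>
    refine Measure.AbsolutelyContinuous.mk fun A hA h0 => ?_
    have hind := (measurable_one (α := ℝ≥0∞)).indicator hA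
    have hKF : Measurable fun s => ∫⁻ t, A.indicator 1 t ∂M.gibbsUpdate x z ℓ s :=
      hind.lintegral_kernel
    have hins : Measurable fun p : M.State n × M.Atom => (ℓ.insertNth p.2 p.1 : M.State (n + 1)) :=
      (MeasurableEquiv.piFinSuccAbove (fun _ => M.Atom) ℓ).symm.measurable.comp measurable_swap
    rw [← lintegral_indicator_one hA, M.lintegral_prior_insertNth ℓ hind] at h0
    have h1 := (mul_eq_zero.1 h0).resolve_left (ENNReal.inv_ne_zero.2 (M.g_ne_top n))
    replace h1 := (lintegral_eq_zero_iff
      (M.measurable_lintegral_urnMeasure (hind.comp hins))).1 h1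
    rw [← lintegral_indicator_one hA,
      Measure.lintegral_bind (M.gibbsUpdate x z ℓ).aemeasurable hind.aemeasurable,
      M.lintegral_prior_insertNth ℓ hKF, lintegral_congr_ae (g := fun _ => 0), lintegral_zero,
      mul_zero]
    filter_upwards [h1] with r hr
    have hr' : ∀ᵐ a ∂M.urnMeasure r, A.indicator (1 : M.State (n + 1) → ℝ≥0∞) (ℓ.insertNth a r) = 0 :=
      (lintegral_eq_zero_iff (hind.comp (hins.comp measurable_prodMk_left))).1 hr
    rw [lintegral_congr (g := fun _ => 0), lintegral_zero]
    intro b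
    rw [M.lintegral_gibbsUpdate_insertNth x z ℓ b r hind, mul_eq_zero]
    refine Or.inr ((lintegral_congr_ae ?_).trans lintegral_zero)
    filter_upwards [hr'] with a ha
    rw [ha, mul_zero]

lemma ae_gibbsUpdate_lik_ne_zero {ℓ ℓ' : Fin N} {s : M.State N}
    (h : ℓ' = ℓ ∨ M.lik x z ℓ' (s ℓ').1 ≠ 0) :
    ∀ᵐ t ∂M.gibbsUpdate x z ℓ s, M.lik x z ℓ' (t ℓ').1 ≠ 0 := by
  have hm : MeasurableSet {t : M.State N | M.lik x z ℓ' (t ℓ').1 ≠ 0} :=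
    ((M.measurable_lik_fst x z ℓ').comp (measurable_pi_apply ℓ'))
      (MeasurableSet.singleton 0).compl
  rw [gibbsUpdate_apply, ae_map_iff (M.measurable_update_const ℓ s).aemeasurable hm]
  by_cases hℓ : ℓ' = ℓ
  · subst hℓ
    simp only [Function.update_self]
    refine Measure.ae_smul_measure ?_ _
    exact (ae_withDensity_iff (M.measurable_lik_fst x z ℓ')).2 (ae_of_all _ fun a ha => ha)
  · simp only [Function.update_of_ne hℓ]
    exact ae_of_all _ fun _ => h.resolve_left hℓ

/-- A redrawn object has nonzero likelihood almost surely, and later updates either leave it alone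
or redraw it in the same way. -/
lemma gibbsUpdates_comp_prior [MeasurableEq Θ] (l : List (Fin N)) :
    M.gibbsUpdates x z l ∘ₘ M.prior N ≪ M.prior N ∧
      ∀ ℓ ∈ l, ∀ᵐ t ∂(M.gibbsUpdates x z l ∘ₘ M.prior N), M.lik x z ℓ (t ℓ).1 ≠ 0 := by
  induction l using List.reverseRecOn with
  | nil =>
    refine ⟨?_, by simp⟩
    rw [gibbsUpdates_nil, Measure.id_comp]
  | append_singleton l ℓ ih =>
    rw [gibbsUpdates_append, ← Measure.comp_assoc]
    refine ⟨(ih.1.comp_right _).trans (M.gibbsUpdate_comp_prior_absolutelyContinuous ℓ),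
      fun ℓ' hℓ' => ?_⟩
    have hm : MeasurableSet {t : M.State N | M.lik x z ℓ' (t ℓ').1 ≠ 0} :=
      ((M.measurable_lik_fst x z ℓ').comp (measurable_pi_apply ℓ'))
        (MeasurableSet.singleton 0).compl
    refine Measure.ae_comp_of_ae_ae hm ?_
    rcases List.mem_append.1 hℓ' with h | h
    · filter_upwards [ih.2 ℓ' h] with s hs
      exact M.ae_gibbsUpdate_lik_ne_zero (Or.inr hs)
    · exact ae_of_all _ fun s => M.ae_gibbsUpdate_lik_ne_zero (Or.inl (List.mem_singleton.1 h))

/-- A posterior null set is prior-null where the joint likelihood is positive, and a full sweep ends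
there almost surely. This permits starting points of zero likelihood. -/
lemma gibbsSweep_comp_prior_absolutelyContinuous [MeasurableEq Θ] (hev : M.evidence x z ≠ ∞) :
    M.gibbsSweep x z ∘ₘ M.prior N ≪ M.posterior x z := by
  obtain ⟨h1, h2⟩ := M.gibbsUpdates_comp_prior (x := x) (z := z) (List.finRange N)
  rw [← gibbsSweep_eq] at h1 h2
  refine Measure.AbsolutelyContinuous.mk fun A hA h0 => ?_
  rw [posterior, Measure.smul_apply, smul_eq_mul, mul_eq_zero] at h0
  have h0' := h0.resolve_left (ENNReal.inv_ne_zero.2 hev)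
  rw [withDensity_apply_eq_zero (M.measurable_jointLik x z)] at h0'
  have hne : ∀ᵐ t ∂(M.gibbsSweep x z ∘ₘ M.prior N), M.jointLik x z t ≠ 0 := by
    have := (ae_all_iff (ι := Fin N)).2 fun ℓ => h2 ℓ (List.mem_finRange ℓ)
    filter_upwards [this] with t ht
    exact Finset.prod_ne_zero_iff.2 fun ℓ _ => ht ℓ
  rw [measure_eq_zero_iff_ae_notMem]
  filter_upwards [hne, measure_eq_zero_iff_ae_notMem.1 (h1 h0')] with t ht htA hA
  exact htA ⟨ht, hA⟩

end Sampler

end DDPModel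

/-! ### Small sets for the Gibbs sweep -/

/-- Redrawing one coordinate of a product measure replaces the corresponding factor. -/
lemma MeasureTheory.Measure.map_update_pi_prod {ι α : Type*} [Fintype ι] [DecidableEq ι]
    [MeasurableSpace α] (μ : ι → Measure α) [∀ i, IsFiniteMeasure (μ i)] (ℓ : ι)
    (hℓ : μ ℓ Set.univ = 1) (ν : Measure α) [IsFiniteMeasure ν] :
    ((Measure.pi μ).prod ν).map (fun p => Function.update p.1 ℓ p.2)
      = Measure.pi (Function.update μ ℓ ν) := by
  have hfin : ∀ i, IsFiniteMeasure (Function.update μ ℓ ν i) := fun i => by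
    by_cases h : i = ℓ
    · subst h; rw [Function.update_self]; infer_instance
    · rw [Function.update_of_ne h]; infer_instance
  have hm : Measurable fun p : (ι → α) × α => Function.update p.1 ℓ p.2 := measurable_update'
  refine (Measure.pi_eq fun A hA => ?_).symm
  have hpre : (fun p : (ι → α) × α => Function.update p.1 ℓ p.2) ⁻¹' (Set.univ.pi A)
      = (Set.univ.pi (Function.update A ℓ Set.univ)) ×ˢ A ℓ := by
    ext p
    simp only [Set.mem_preimage, Set.mem_univ_pi, Set.mem_prod]
    constructor
    · refine fun h => ⟨fun i => ?_, by simpa using h ℓ⟩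
      by_cases hi : i = ℓ
      · subst hi; simp
      · simpa [Function.update_of_ne hi] using h i
    · rintro ⟨h1, h2⟩ i
      by_cases hi : i = ℓ
      · subst hi; simpa using h2
      · simpa [Function.update_of_ne hi] using h1 i
  rw [Measure.map_apply hm (MeasurableSet.univ_pi hA), hpre, Measure.prod_prod, Measure.pi_pi,
    ← Finset.mul_prod_erase _ _ (Finset.mem_univ ℓ), ← Finset.mul_prod_erase _ _ (Finset.mem_univ ℓ),
    Function.update_self, Function.update_self, hℓ, one_mul, mul_comm]
  congr 1
  refine Finset.prod_congr rfl fun i hi => ?_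
  rw [Function.update_of_ne (Finset.ne_of_mem_erase hi),
    Function.update_of_ne (Finset.ne_of_mem_erase hi)]

namespace DDPModel

variable {Θ 𝓧 𝓩 : Type*} [MeasurableSpace Θ] (M : DDPModel Θ 𝓧 𝓩)
variable {N : ℕ} (x : Fin N → 𝓧) (z : Fin N → 𝓩)

/-- The part of an unnormalised full conditional that creates a new cluster. -/
noncomputable def newClusterMeasure (ℓ : Fin N) : Measure M.Atom :=
  ((M.α : ℝ≥0∞) • M.H.prod (Measure.dirac none)).withDensity fun a => M.lik x z ℓ a.1

lemma newClusterMeasure_univ (ℓ : Fin N) :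
    M.newClusterMeasure x z ℓ Set.univ = M.α * ∫⁻ θ, M.lik x z ℓ θ ∂M.H := by
  rw [newClusterMeasure, withDensity_apply _ MeasurableSet.univ, Measure.restrict_univ,
    lintegral_smul_measure, Measure.prod_dirac,
    lintegral_map (M.measurable_lik_fst x z ℓ) measurable_prodMk_right, smul_eq_mul]

lemma newClusterMeasure_le (ℓ : Fin N) (s : M.State N) :
    M.newClusterMeasure x z ℓ ≤ M.gibbsMeasure x z ℓ s := by
  refine Measure.le_iff.2 fun A hA => ?_
  rw [newClusterMeasure, gibbsMeasure, withDensity_apply _ hA, withDensity_apply _ hA]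
  exact lintegral_mono' (Measure.restrict_mono_measure (Measure.le_add_left le_rfl) A) le_rfl

/-- The atoms at which all likelihoods are bounded by `m`. -/
def boundedAtoms (m : ℕ) : Set M.Atom := {a | ∀ ℓ, M.lik x z ℓ a.1 ≤ m}

lemma measurableSet_boundedAtoms (m : ℕ) : MeasurableSet (M.boundedAtoms x z m) := by
  rw [boundedAtoms, Set.ofPred_forall]
  exact MeasurableSet.iInter fun ℓ =>
    measurableSet_le (M.measurable_lik_fst x z ℓ) measurable_const

lemma monotone_boundedAtoms : Monotone (M.boundedAtoms x z) := fun m m' hm _ ha ℓ =>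
  (ha ℓ).trans (by exact_mod_cast hm)

lemma iUnion_boundedAtoms : ⋃ m, M.boundedAtoms x z m = Set.univ := by
  refine Set.eq_univ_of_forall fun a => Set.mem_iUnion.2 ?_
  obtain ⟨m, hm⟩ := exists_nat_ge (∑ ℓ, M.R a.1 (x ℓ) (z ℓ))
  refine ⟨m, fun ℓ => ?_⟩
  have h : M.R a.1 (x ℓ) (z ℓ) ≤ m := (Finset.single_le_sum
    (f := fun ℓ => M.R a.1 (x ℓ) (z ℓ)) (fun _ _ => zero_le) (Finset.mem_univ ℓ)).trans hm
  rw [lik]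
  exact_mod_cast h

lemma smul_map_update_le_gibbsUpdate (ℓ : Fin N) {m : ℕ} {s : M.State N}
    (hs : ∀ i, s i ∈ M.boundedAtoms x z m) :
    (M.normaliserBound x z ℓ m)⁻¹ •
      ((M.newClusterMeasure x z ℓ).restrict (M.boundedAtoms x z m)).map (Function.update s ℓ)
        ≤ M.gibbsUpdate x z ℓ s := by
  have hm := M.measurable_update_const ℓ s
  rw [gibbsUpdate_apply]
  change _ ≤ Measure.map _ ((M.gibbsMeasure x z ℓ s Set.univ)⁻¹ • M.gibbsMeasure x z ℓ s)
  rw [Measure.map_smul]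
  refine Measure.le_iff.2 fun A hA => ?_
  rw [Measure.smul_apply, Measure.smul_apply, smul_eq_mul, smul_eq_mul,
    Measure.map_apply hm hA, Measure.map_apply hm hA]
  refine mul_le_mul' (ENNReal.inv_le_inv.2 (M.gibbsMeasure_univ_le x z ℓ s fun i => hs i ℓ)) ?_
  exact (Measure.restrict_le_self _).trans (M.newClusterMeasure_le x z ℓ s _)

variable {x z}

lemma isFiniteMeasure_newClusterMeasure [MeasurableEq Θ]
    (hH : ∀ ℓ, ∫⁻ θ, M.lik x z ℓ θ ∂M.H ≠ 0) (hev : M.evidence x z ≠ ∞) (ℓ : Fin N) :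
    IsFiniteMeasure (M.newClusterMeasure x z ℓ) := by
  refine ⟨?_⟩
  rw [newClusterMeasure_univ]
  cases N with
  | zero => exact ℓ.elim0
  | succ n => exact (M.integrals_lik_ne_top ℓ hH hev).1.lt_top

/-- On states with bounded likelihoods, the updates dominate a multiple of the law under which each
updated object independently opens a new cluster. -/
lemma exists_smul_pi_le_gibbsUpdates [MeasurableEq Θ] (hH : ∀ ℓ, ∫⁻ θ, M.lik x z ℓ θ ∂M.H ≠ 0)
    (hev : M.evidence x z ≠ ∞) (m : ℕ) {l : List (Fin N)} (hl : l.Nodup) :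
    ∃ ε : ℝ≥0∞, ε ≠ 0 ∧ ∀ s : M.State N, (∀ i, s i ∈ M.boundedAtoms x z m) →
      ε • Measure.pi (fun i => if i ∈ l then
        (M.newClusterMeasure x z i).restrict (M.boundedAtoms x z m) else Measure.dirac (s i))
          ≤ M.gibbsUpdates x z l s := by
  have hfin := M.isFiniteMeasure_newClusterMeasure hH hev
  induction l using List.reverseRecOn with
  | nil =>
    refine ⟨1, one_ne_zero, fun s _ => ?_⟩
    simp only [List.not_mem_nil, if_false, one_smul, gibbsUpdates_nil, Kernel.id_apply]
    refine (Measure.pi_eq fun A hA => ?_).le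
    simp_rw [Measure.dirac_apply' _ (MeasurableSet.univ_pi hA), Measure.dirac_apply' _ (hA _)]
    by_cases h : ∀ i, s i ∈ A i
    · simp [h]
    · obtain ⟨i, hi⟩ := not_forall.1 h
      rw [Finset.prod_eq_zero (Finset.mem_univ i) (Set.indicator_of_notMem hi _),
        Set.indicator_of_notMem fun hs : s ∈ Set.univ.pi A => hi (hs i trivial)]
  | append_singleton l ℓ ih =>
    rw [List.nodup_append] at hl
    have hℓ : ℓ ∉ l := fun h => hl.2.2 ℓ h ℓ (List.mem_singleton_self ℓ) rfl
    obtain ⟨ε, hε, hle⟩ := ih hl.1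
    have hC : (M.normaliserBound x z ℓ m)⁻¹ ≠ 0 :=
      ENNReal.inv_ne_zero.2 (M.normaliserBound_ne_top hH hev ℓ (ENNReal.natCast_ne_top m))
    refine ⟨ε * (M.normaliserBound x z ℓ m)⁻¹, mul_ne_zero hε hC, fun s hs => ?_⟩
    set ν := (M.newClusterMeasure x z ℓ).restrict (M.boundedAtoms x z m) with hν
    set μ : Fin N → Measure M.Atom := fun i => if i ∈ l then
      (M.newClusterMeasure x z i).restrict (M.boundedAtoms x z m) else Measure.dirac (s i) with hμ
    have hμfin : ∀ i, IsFiniteMeasure (μ i) := fun i => by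
      simp only [hμ]; split_ifs <;> infer_instance
    have hμb : ∀ i, ∀ᵐ a ∂μ i, a ∈ M.boundedAtoms x z m := fun i => by
      simp only [hμ]
      split_ifs
      · exact ae_restrict_mem (M.measurableSet_boundedAtoms x z m)
      · exact (ae_dirac_iff (M.measurableSet_boundedAtoms x z m)).2 (hs i)
    -- New parameters are restricted to bounded likelihoods, so the dominated part never leaves the
    -- bounded states and the same normaliser bound serves the next update.
    have hpib : ∀ᵐ t ∂Measure.pi μ, ∀ i, t i ∈ M.boundedAtoms x z m :=
      ae_all_iff.2 fun i => Measure.tendsto_eval_ae_ae.eventually (hμb i)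
    have hupd : (fun i => if i ∈ l ++ [ℓ] then
        (M.newClusterMeasure x z i).restrict (M.boundedAtoms x z m) else Measure.dirac (s i))
        = Function.update μ ℓ ν := by
      funext i
      by_cases h : i = ℓ
      · subst h; simp [hν]
      · simp [h, hμ]
    have hμℓ : μ ℓ Set.univ = 1 := by simp [hμ, hℓ]
    rw [hupd, ← Measure.map_update_pi_prod μ ℓ hμℓ ν, gibbsUpdates_append, Kernel.comp_apply]
    refine le_trans ?_ (Kernel.comp_measure_mono _ (hle s hs))
    rw [Measure.comp_smul]
    refine Measure.le_iff.2 fun A hA => ?_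
    have hm : Measurable fun p : M.State N × M.Atom => Function.update p.1 ℓ p.2 :=
      measurable_update'
    rw [Measure.smul_apply, Measure.smul_apply, smul_eq_mul, smul_eq_mul, mul_assoc,
      Measure.map_apply hm hA, Measure.prod_apply (hm hA),
      Measure.bind_apply hA (M.gibbsUpdate x z ℓ).aemeasurable,
      ← lintegral_const_mul _ (measurable_measure_prodMk_left (hm hA))]
    gcongr ε * ?_
    refine lintegral_mono_ae ?_
    filter_upwards [hpib] with t ht
    refine le_trans (le_of_eq ?_) (M.smul_map_update_le_gibbsUpdate x z ℓ ht A)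
    rw [Measure.smul_apply, smul_eq_mul, Measure.map_apply (M.measurable_update_const ℓ t) hA]
    rfl

/-- A full sweep redraws every object, so the product measure below it no longer depends on the
starting state. The bound `m` is taken large enough both for the posterior to charge the bounded
states and for every new-cluster measure to charge the bounded atoms. -/
lemma exhaustedBySmallSets_gibbsSweep [MeasurableEq Θ]
    (hH : ∀ ℓ, ∫⁻ θ, M.lik x z ℓ θ ∂M.H ≠ 0) (hev : M.evidence x z ≠ ∞) :
    Kernel.ExhaustedBySmallSets (M.gibbsSweep x z) (M.posterior x z) := by
  intro η hη
  have hfin := M.isFiniteMeasure_newClusterMeasure hH hev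
  have hb := M.measurableSet_boundedAtoms x z
  let B : ℕ → Set (M.State N) := fun m => {s | ∀ i, s i ∈ M.boundedAtoms x z m}
  have hB : ∀ m, MeasurableSet (B m) := fun m => by
    simp only [B]
    rw [Set.ofPred_forall]
    exact MeasurableSet.iInter fun i => measurable_pi_apply i (hb m)
  have hBmono : Monotone B := fun m m' hm s hs i => M.monotone_boundedAtoms x z hm (hs i)
  have hBunion : ⋂ m, (B m)ᶜ = ∅ := by
    rw [← Set.compl_iUnion, Set.compl_empty_iff]
    refine Set.eq_univ_of_forall fun s => Set.mem_iUnion.2 ?_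
    have hex : ∀ i, ∃ m, s i ∈ M.boundedAtoms x z m := fun i => by
      rw [← Set.mem_iUnion, iUnion_boundedAtoms]; trivial
    choose m hm using hex
    exact ⟨Finset.univ.sup m, fun i =>
      M.monotone_boundedAtoms x z (Finset.le_sup (Finset.mem_univ i)) (hm i)⟩
  have hlim : Tendsto (fun m => M.posterior x z (B m)ᶜ) atTop (𝓝 0) := by
    have := tendsto_measure_iInter_atTop (μ := M.posterior x z)
      (fun m => (hB m).compl.nullMeasurableSet)
      (fun m m' hm => Set.compl_subset_compl.2 (hBmono hm)) ⟨0, measure_ne_top _ _⟩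
    rwa [hBunion, measure_empty] at this
  have hnew : ∀ᶠ m in atTop, ∀ ℓ, M.newClusterMeasure x z ℓ (M.boundedAtoms x z m) ≠ 0 := by
    refine eventually_all.2 fun ℓ => ?_
    have hα : (M.α : ℝ≥0∞) ≠ 0 := by exact_mod_cast M.α_pos.ne'
    have := tendsto_measure_iUnion_atTop (μ := M.newClusterMeasure x z ℓ)
      (M.monotone_boundedAtoms x z)
    rw [iUnion_boundedAtoms, newClusterMeasure_univ] at this
    exact this.eventually_ne (mul_ne_zero hα (hH ℓ))
  obtain ⟨m, hm, hpos⟩ :=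
    ((hlim.eventually (ge_mem_nhds (pos_iff_ne_zero.2 hη))).and hnew).exists
  obtain ⟨ε, hε, hle⟩ := M.exists_smul_pi_le_gibbsUpdates hH hev m (List.nodup_finRange N)
  refine ⟨B m, hB m, hm, ε • Measure.pi fun i =>
    (M.newClusterMeasure x z i).restrict (M.boundedAtoms x z m), ?_, fun s hs => ?_⟩
  · rw [Measure.smul_apply, Measure.pi_univ, smul_eq_mul]
    refine mul_ne_zero hε (Finset.prod_ne_zero_iff.2 fun i _ => ?_)
    rw [Measure.restrict_apply_univ]
    exact hpos i
  · simpa only [List.mem_finRange, if_true, ← gibbsSweep_eq] using hle s hs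

lemma measurable_params : Measurable (M.params : M.State N → Fin N → Θ) :=
  measurable_pi_lambda _ fun i => measurable_fst.comp (measurable_pi_apply i)

end DDPModel

theorem mainTheorem4 {Θ 𝓧 𝓩 : Type*} [TopologicalSpace Θ] [PolishSpace Θ] [MeasurableSpace Θ]
    [BorelSpace Θ] (M : DDPModel Θ 𝓧 𝓩) {N : ℕ} (x : Fin N → 𝓧) (z : Fin N → 𝓩)
    (hH : ∀ ℓ, ∫⁻ θ, M.lik x z ℓ θ ∂M.H ≠ 0)
    (hev : M.evidence x z ≠ ∞) :
    IsProbabilityMeasure (M.posterior x z) ∧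
    IsMarkovKernel (M.gibbsSweep x z) ∧
    ∀ᵐ s ∂(M.prior N),
      Tendsto (fun n => tvNorm (M.Ψ x z n s) (M.posterior x z)) atTop (𝓝 0) ∧
      Tendsto (fun n => tvNorm ((M.Ψ x z n s).map M.params) ((M.posterior x z).map M.params))
        atTop (𝓝 0) := by
  have hprob := M.isProbabilityMeasure_posterior hH hev
  have hmarkov : IsMarkovKernel (M.gibbsSweep x z) := M.isMarkovKernel_gibbsUpdates hH hev _
  have hinv : (M.gibbsSweep x z).Invariant (M.posterior x z) := M.invariant_gibbsUpdates hH hev _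
  refine ⟨hprob, hmarkov, ?_⟩
  -- The prior serves as the measure of initial states. Overlap passes to images, which gives the
  -- statement for the parameters alone.
  filter_upwards [Kernel.ae_forall_eventually_overlapWithin hinv (M.exhaustedBySmallSets_gibbsSweep hH hev)
    (M.gibbsSweep_comp_prior_absolutelyContinuous hev)] with s hs
  constructor <;> refine ENNReal.tendsto_nhds_zero.2 fun ε hε => ?_
  · filter_upwards [hs (ε / 2) (ENNReal.half_pos hε.ne').ne'] with n hn
    exact hn.tvNorm_le.trans (ENNReal.add_halves ε).le
  · filter_upwards [hs (ε / 2) (ENNReal.half_pos hε.ne').ne'] with n hn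
    exact (hn.map M.measurable_params).tvNorm_le.trans (ENNReal.add_halves ε).le
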